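/- **Setup.** Let $d\ge 0$, $q\ge 1$, let $\Lambda\subset\mathbb Z^d$ be finite, and let $\mathcal H_\Lambda=(\mathbb C^q)^{\otimes\Lambda}$, with $\|\cdot\|$ the operator norm. A *potential* is a family $Z=(Z_S)$ of operators, indexed by the nonempty nearest-neighbour-connected sets $S\subset\Lambda$, with $Z_S$ acting within $S$ (i.e. $Z_S$ is of the form $1_{\Lambda\setminus S}\otimes B$); it is identified with the operator $\sum_S Z_S$ when an operator is meant, and it is called (anti-)Hermitian if all $Z_S$ are. For $\kappa>0$ put $$\|Z\|_\kappa=\sup_{x\in\Lambda}\sum_{S\ni x}e^{\kappa|S|}\|Z_S\| .$$ For potentials $Q,Z$ put $(\mathrm{ad}_Q Z)_S=\sum_{S_1\cup S_2=S}[Q_{S_1},Z_{S_2}]$ and $e^{\mathrm{ad}_Q}Z=\sum_{k\ge0}\frac1{k!}\mathrm{ad}_Q^kZ$. Let $N=\sum_{x\in\Lambda}N_x$ with $N_x$ Hermitian, acting on site $x$ and with $\sigma(N_x)\subset\mathbb Z$; as a potential, $N$ has the term $N_x$ on $\{x\}$. For an operator $O$ let $\langle O\rangle=\sum_{n\in\mathbb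 Z}\chi(N=n)\,O\,\chi(N=n)$, and for a potential let $\langle Z\rangle_S=\langle Z_S\rangle$. Let $H$ be a Hermitian potential, $D=\langle H\rangle$ and $V=H-D$. For $\kappa_0>0$ and $\nu\in\mathbb R$ let $$\nu_0=\frac{54\pi}{\kappa_0^2}\left(\|D\|_{\kappa_0}+2\|V\|_{\kappa_0}\right),\qquad n_*=\left\lfloor\frac{\nu/\nu_0}{(1+\ln(\nu/\nu_0))^3}\right\rfloor-2,\qquad \kappa_{n_*}=\frac{\kappa_0}{1+\ln(n_*+1)} .$$ **Theorem.** There is a numerical constant $C>0$, independent of all of $d,q,\Lambda,(N_x),H,\kappa_0,\nu$, such that the following holds. Assume $H\ne0$ and $$\nu\ge\frac{9\pi\|V\|_{\kappa_0}}{\kappa_0},\qquad \nu\ge\nu_0,\qquad n_*\ge1 .$$ Then there are Hermitian potentials $\widehat H,\widehat D,\widehat V$ and a unitary $Y=e^{A_{n_*}}\cdots e^{A_0}$, with anti-Hermitian potentials $A_0,\dots,A_{n_*}$, such that $$Y(\nu N+H)Y^*=\nu N+\widehat H=\nu N+\widehat D+\widehat V,$$ both as operators and as potentials, where for a potential $Z$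 the potential $YZY^*$ is understood as $e^{\mathrm{ad}_{A_{n_*}}}\cdots e^{\mathrm{ad}_{A_0}}Z$ (a potential, whose operator is indeed $YZY^*$), and 1. $\widehat D=\langle\widehat H\rangle$ (as potentials and as operators), and $[\widehat D,N]=0$; 2. $\displaystyle\|\widehat D-D\|_{\kappa_{n_*}}\le C\,\frac{\nu_0}{\nu}\,\|V\|_{\kappa_0}$ and $\displaystyle\|\widehat V\|_{\kappa_{n_*}}\le\left(\tfrac23\right)^{n_*}\|V\|_{\kappa_0}$; 3. $\displaystyle\|YZY^*-Z\|_{\kappa_{n_*}}\le C\,\frac{\nu_0}{\nu}\,\|Z\|_{\kappa_0}$ for every potential $Z$. -/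

import Mathlib

open scoped Matrix.Norms.L2Operator

noncomputable section

namespace SpinSystem

/-- The nearest-neighbour graph of the lattice `ℤ^d` (sites at `ℓ¹`-distance one are adjacent). -/
def latticeGraph (d : ℕ) : SimpleGraph (Fin d → ℤ) where
  Adj x y := ∑ i, |x i - y i| = 1
  symm := ⟨fun x y h => by
    rw [← h]
    exact Finset.sum_congr rfl fun i _ => abs_sub_comm _ _⟩
  loopless := ⟨fun x h => by simp at h⟩

variable {d : ℕ}

/-- `S ⊆ Λ` is a (nonempty) connected set of lattice sites. -/
def IsConnectedSet {Λ : Finset (Fin d → ℤ)} (S : Finset Λ) : Prop :=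
  ((latticeGraph d).induce (Subtype.val '' (S : Set Λ))).Connected

/-- The operators on `(ℂ^q)^{⊗ Λ}`, as matrices in the product basis `|η⟩`, `η : Λ → {0,…,q-1}`.
The norm on them is the operator norm for the Hilbert space norm. -/
abbrev Op (Λ : Finset (Fin d → ℤ)) (q : ℕ) : Type :=
  Matrix (Λ → Fin q) (Λ → Fin q) ℂ

variable {Λ : Finset (Fin d → ℤ)} {q : ℕ}

/-- `O` acts within `S`: it is of the form `1_{Λ ∖ S} ⊗ B`. -/
def ActsWithin (S : Finset Λ) (O : Op Λ q) : Prop :=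
  ∃ B : Matrix (S → Fin q) (S → Fin q) ℂ, ∀ σ τ : Λ → Fin q,
    O σ τ = open Classical in
      if ∀ x, x ∉ S → σ x = τ x then B (fun x => σ x) (fun x => τ x) else 0

/-- Families of operators indexed by the subsets of `Λ`. -/
abbrev Family (Λ : Finset (Fin d → ℤ)) (q : ℕ) : Type := Finset Λ → Op Λ q

/-- A potential is a family `(Z_S)` over the connected subsets `S` of `Λ` (extended by zero to the
other subsets) such that `Z_S` acts within `S`. -/
def IsPotential (Z : Family Λ q) : Prop :=
  (∀ S, ActsWithin S (Z S)) ∧ ∀ S, ¬ IsConnectedSet S → Z S = 0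

/-- The operator `∑_S Z_S` of a potential. -/
def toOp (Z : Family Λ q) : Op Λ q := ∑ S, Z S

/-- All terms are Hermitian. -/
def IsHermitianFamily (Z : Family Λ q) : Prop := ∀ S, (Z S).IsHermitian

/-- All terms are anti-Hermitian. -/
def IsAntiHermitianFamily (Z : Family Λ q) : Prop := ∀ S, (Z S).conjTranspose = - Z S

open Classical in
/-- The norm `‖Z‖_κ = sup_{x ∈ Λ} ∑_{S ∋ x connected} e^{κ |S|} ‖Z_S‖`. -/
def potNorm (κ : ℝ) (Z : Family Λ q) : ℝ :=
  ⨆ x : Λ, ∑ S : Finset Λ with IsConnectedSet S ∧ x ∈ S, Real.exp (κ * S.card) * ‖Z S‖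

/-- The commutator of potentials, `(ad_Q Z)_S = ∑_{S₁ ∪ S₂ = S} [Q_{S₁}, Z_{S₂}]`. -/
def adPot (Q Z : Family Λ q) : Family Λ q := fun S =>
  ∑ S₁ : Finset Λ, ∑ S₂ : Finset Λ,
    if S₁ ∪ S₂ = S then Q S₁ * Z S₂ - Z S₂ * Q S₁ else 0

/-- The potential `e^{ad_Q} Z = ∑_k (1/k!) ad_Q^k Z`. -/
def expAd (Q Z : Family Λ q) : Family Λ q := fun S =>
  ∑' k : ℕ, ((k.factorial : ℂ)⁻¹) • ((adPot Q)^[k] Z) S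

/-- The operator `e^{A_{k-1}} ⋯ e^{A_0}`. -/
def dressing (A : ℕ → Family Λ q) : ℕ → Op Λ q
  | 0 => 1
  | k + 1 => NormedSpace.exp (toOp (A k)) * dressing A k

/-- The potential `e^{ad_{A_{k-1}}} ⋯ e^{ad_{A_0}} Z`. -/
def dressPot (A : ℕ → Family Λ q) (Z : Family Λ q) : ℕ → Family Λ q
  | 0 => Z
  | k + 1 => expAd (A k) (dressPot A Z k)

/-- `(N_x)` is a family of number operators: `N_x` is Hermitian, acts on the site `x`, and has
integer spectrum. -/
def IsNumberFamily (N : Λ → Op Λ q) : Prop :=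
  ∀ x, ActsWithin {x} (N x) ∧ (N x).IsHermitian ∧
    spectrum ℂ (N x) ⊆ Set.range (fun n : ℤ => (n : ℂ))

/-- The potential of `N = ∑_x N_x`: the term `N_x` on `{x}`. -/
def numPot (N : Λ → Op Λ q) : Family Λ q := fun S => ∑ x, if S = {x} then N x else 0

/-- The spectral projection `χ(M = n)` of a Hermitian operator `M`. -/
def specProj (M : Op Λ q) (n : ℤ) : Op Λ q :=
  cfc (Set.indicator {(n : ℝ)} (fun _ : ℝ => (1 : ℝ))) M

/-- `⟨O⟩ = ∑_{n ∈ ℤ} χ(N = n) O χ(N = n)`, where `N = ∑_x N_x`. -/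
def diagPart (N : Λ → Op Λ q) (O : Op Λ q) : Op Λ q :=
  ∑ᶠ n : ℤ, specProj (∑ x, N x) n * O * specProj (∑ x, N x) n

/-- The potential `D = ⟨H⟩`, with the terms `D_S = ⟨H_S⟩`. -/
def diagPot (N : Λ → Op Λ q) (H : Family Λ q) : Family Λ q := fun S => diagPart N (H S)

/-- The potential `V = H - ⟨H⟩`. -/
def offPot (N : Λ → Op Λ q) (H : Family Λ q) : Family Λ q := H - diagPot N H

/-- `ν₀ = (54 π / κ₀²) (‖D‖_{κ₀} + 2 ‖V‖_{κ₀})`. -/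
def nuZero (κ₀ : ℝ) (N : Λ → Op Λ q) (H : Family Λ q) : ℝ :=
  54 * Real.pi / κ₀ ^ 2 * (potNorm κ₀ (diagPot N H) + 2 * potNorm κ₀ (offPot N H))

/-- `n_* = ⌊ r / (1 + ln r)³ ⌋ - 2` with `r = ν / ν₀`. The truncated subtraction is harmless: this is
only used when `n_* ≥ 1`. -/
def nStar (ν ν₀ : ℝ) : ℕ := ⌊(ν / ν₀) / (1 + Real.log (ν / ν₀)) ^ 3⌋₊ - 2

/-- The decay rate `κ_n = κ₀ (1 + log (n + 1))⁻¹`. -/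
def decayRate (κ₀ : ℝ) (n : ℕ) : ℝ := κ₀ * (1 + Real.log (n + 1))⁻¹

end SpinSystem

end

/-! ### Periodic Heisenberg evolution in a C*-algebra: its mean and its sawtooth integral. -/

section Rotation

open MeasureTheory Complex

variable {𝔄 : Type*} [CStarAlgebra 𝔄]

/-! The off-diagonal part is removed iteratively. Since `N` has integer spectrum, conjugation by
`e^{itN}` is 2π-periodic in `t`. Its mean over a period is `⟨·⟩` (`diagPart_eq_rotAverage`), and its
integral against the sawtooth `t - π` inverts the commutator with `N` on off-diagonal operators
(`commutator_rotSawtooth`). Since `N` is a sum of commuting on-site terms, neither operation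
enlarges supports. So every off-diagonal `V` has a generator `A` with `[A, νN] = -V`, supported on
the same sets and of norm at most `π/ν` times that of `V`. In `e^{ad_A}(νN + D + V)` the term `[A,
νN]` cancels `V`, and what remains beyond `νN + D` is of first order in `A`
(`IsNumberFamily.hasSum_renormalize`).

The price is decay rate. Only overlapping sets contribute to a commutator of potentials, and
counting overlaps costs a factor `|S|`, which is absorbed by lowering the rate by `δ`, at a cost
`1/δ`. When the loss is split evenly among `k` nested commutators, `k^k/k! ≤ e^k` makes the
exponential series geometric in `‖A‖_{κ+δ}/(κδ)` (`potNorm_factorial_adPot_iterate_le`,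
`potNorm_adPot_series_le`).

The rates `κ_n` satisfy `κ_{n+1}(κ_n - κ_{n+1}) ≥ κ₀²/rateGrowth n`, and `n_*` is chosen so that
`rateGrowth n ≤ ν/ν₀` for all `n < n_*`. In this range each step shrinks `V` by at least the factor
`2/3` while `D` stays bounded (`recursion_bounds`). Keeping the factor `ν₀/ν` in the size of each
step, the remaining weights grow polynomially times `(2/3)^n`, so they have a finite sum that is a
pure number. This yields `C`, directly for the change of `D` and through a discrete Gronwall
argument for the dressing of a general potential (`recursion_dressed`). -/

/-- The propagator `e^{itM}`. -/
noncomputable def propagator (M : 𝔄) (t : ℝ) : 𝔄 := NormedSpace.exp ((t : ℂ) • (I • M))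

/-- The Heisenberg evolution `e^{itM} O e^{-itM}`. -/
noncomputable def rotate (M : 𝔄) (t : ℝ) (O : 𝔄) : 𝔄 := propagator M t * O * propagator M (-t)

/-- The average of the Heisenberg evolution over one period. -/
noncomputable def rotAverage (M O : 𝔄) : 𝔄 :=
  (2 * Real.pi : ℂ)⁻¹ • ∫ t in (0 : ℝ)..2 * Real.pi, rotate M t O

/-- The Heisenberg evolution integrated against the sawtooth `t - π` over one period. -/
noncomputable def rotSawtooth (M O : 𝔄) : 𝔄 :=
  (2 * Real.pi : ℂ)⁻¹ • ∫ t in (0 : ℝ)..2 * Real.pi, ((t - Real.pi : ℝ) : ℂ) • rotate M t O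

@[simp] lemma propagator_zero (M : 𝔄) : propagator M 0 = 1 := by simp [propagator]

lemma propagator_add (M : 𝔄) (s t : ℝ) :
    propagator M (s + t) = propagator M s * propagator M t := by
  let _ : NormedAlgebra ℚ 𝔄 := NormedAlgebra.restrictScalars ℚ ℂ 𝔄
  rw [propagator, propagator, propagator, ← NormedSpace.exp_add_of_commute]
  · push_cast; rw [add_smul]
  · exact ((Commute.refl _).smul_left _).smul_right _

lemma propagator_mul_neg (M : 𝔄) (t : ℝ) : propagator M t * propagator M (-t) = 1 := by
  rw [← propagator_add]; simp

lemma propagator_neg_mul (M : 𝔄) (t : ℝ) : propagator M (-t) * propagator M t = 1 := by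
  rw [← propagator_add]; simp

lemma star_propagator {M : 𝔄} (hM : IsSelfAdjoint M) (t : ℝ) :
    star (propagator M t) = propagator M (-t) := by
  rw [propagator, NormedSpace.star_exp, propagator]
  congr 1
  simp [hM.star_eq]

lemma propagator_mem_unitary {M : 𝔄} (hM : IsSelfAdjoint M) (t : ℝ) :
    propagator M t ∈ unitary 𝔄 := by
  rw [Unitary.mem_iff, star_propagator hM]
  exact ⟨propagator_neg_mul M t, propagator_mul_neg M t⟩

lemma hasDerivAt_propagator (M : 𝔄) (t : ℝ) :
    HasDerivAt (propagator M) (propagator M t * (I • M)) t :=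
  (hasDerivAt_exp_smul_const (𝕂 := ℂ) (I • M) (t : ℂ)).scomp t Complex.ofRealCLM.hasDerivAt
    |>.congr_deriv (by simp [propagator])

lemma commute_propagator {M O : 𝔄} (h : Commute M O) (t : ℝ) : Commute (propagator M t) O := by
  let _ : NormedAlgebra ℚ 𝔄 := NormedAlgebra.restrictScalars ℚ ℂ 𝔄
  exact ((h.smul_left _).smul_left _).exp_left

lemma norm_rotate {M : 𝔄} (hM : IsSelfAdjoint M) (t : ℝ) (O : 𝔄) : ‖rotate M t O‖ = ‖O‖ := by
  rw [rotate, CStarRing.norm_mul_mem_unitary _ (propagator_mem_unitary hM (-t)),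
    CStarRing.norm_mem_unitary_mul _ (propagator_mem_unitary hM t)]

lemma hasDerivAt_rotate (M O : 𝔄) (t : ℝ) :
    HasDerivAt (fun t => rotate M t O) (I • (M * rotate M t O - rotate M t O * M)) t := by
  have h1 := hasDerivAt_propagator M t
  have h2 : HasDerivAt (fun s => propagator M (-s)) (-(propagator M (-t) * (I • M))) t := by
    simpa [Function.comp_def] using (hasDerivAt_propagator M (-t)).scomp t (hasDerivAt_neg t)
  refine ((h1.mul_const O).mul h2).congr_deriv ?_
  have hc : propagator M t * M = M * propagator M t := commute_propagator (Commute.refl M) t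
  simp only [rotate, mul_smul_comm, smul_mul_assoc, mul_neg, smul_sub, hc, mul_assoc]
  rw [sub_eq_add_neg]

lemma continuous_rotate (M O : 𝔄) : Continuous fun t => rotate M t O :=
  continuous_iff_continuousAt.2 fun t => (hasDerivAt_rotate M O t).continuousAt

lemma rotate_add (M : 𝔄) (t : ℝ) (O P : 𝔄) : rotate M t (O + P) = rotate M t O + rotate M t P := by
  simp [rotate, mul_add, add_mul]

lemma rotate_smul (M : 𝔄) (t : ℝ) (c : ℂ) (O : 𝔄) : rotate M t (c • O) = c • rotate M t O := by
  simp [rotate]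

lemma star_rotate {M : 𝔄} (hM : IsSelfAdjoint M) (t : ℝ) (O : 𝔄) :
    star (rotate M t O) = rotate M t (star O) := by
  simp [rotate, star_propagator hM, mul_assoc]

lemma rotate_of_commute {M O : 𝔄} (h : Commute M O) (t : ℝ) : rotate M t O = O := by
  rw [rotate, (commute_propagator h t).eq, mul_assoc, propagator_mul_neg, mul_one]

lemma rotate_two_pi {M : 𝔄} (h : propagator M (2 * Real.pi) = 1) (O : 𝔄) :
    rotate M (2 * Real.pi) O = O := by
  have h' := propagator_mul_neg M (2 * Real.pi)
  rw [h, one_mul] at h'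
  rw [rotate, h, h']; simp

lemma two_pi_smul_cancel (O : 𝔄) : (2 * Real.pi : ℂ)⁻¹ • (2 * Real.pi : ℂ) • O = O := by
  rw [smul_smul, inv_mul_cancel₀, one_smul]
  simp [Real.pi_ne_zero]

lemma rotAverage_of_commute {M O : 𝔄} (h : Commute M O) : rotAverage M O = O := by
  simp only [rotAverage, rotate_of_commute h, intervalIntegral.integral_const]
  rw [sub_zero, ← Complex.coe_smul]
  push_cast
  exact two_pi_smul_cancel O

lemma rotAverage_add (M O P : 𝔄) : rotAverage M (O + P) = rotAverage M O + rotAverage M P := by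
  simp only [rotAverage, rotate_add]
  rw [intervalIntegral.integral_add ((continuous_rotate M O).intervalIntegrable _ _)
    ((continuous_rotate M P).intervalIntegrable _ _), smul_add]

lemma rotAverage_smul (M : 𝔄) (c : ℂ) (O : 𝔄) : rotAverage M (c • O) = c • rotAverage M O := by
  simp only [rotAverage, rotate_smul]
  rw [intervalIntegral.integral_smul, smul_comm]

lemma rotAverage_sub (M O P : 𝔄) : rotAverage M (O - P) = rotAverage M O - rotAverage M P := by
  rw [sub_eq_add_neg, ← neg_one_smul ℂ P, rotAverage_add, rotAverage_smul, neg_one_smul,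
    ← sub_eq_add_neg]

lemma norm_rotAverage_le {M : 𝔄} (hM : IsSelfAdjoint M) (O : 𝔄) : ‖rotAverage M O‖ ≤ ‖O‖ := by
  have h := intervalIntegral.norm_integral_le_of_norm_le_const (a := 0) (b := 2 * Real.pi)
    (f := fun t => rotate M t O) (C := ‖O‖) fun t _ => (norm_rotate hM t O).le
  have hp := Real.pi_pos
  rw [sub_zero, abs_of_pos (by positivity)] at h
  rw [rotAverage, norm_smul]
  simp only [norm_inv, norm_mul, norm_real, Real.norm_eq_abs, abs_of_pos hp, Complex.norm_ofNat]
  rw [inv_mul_le_iff₀ (by positivity)]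
  linarith

lemma norm_rotSawtooth_le {M : 𝔄} (hM : IsSelfAdjoint M) (O : 𝔄) :
    ‖rotSawtooth M O‖ ≤ Real.pi * ‖O‖ := by
  have hp := Real.pi_pos
  have h := intervalIntegral.norm_integral_le_of_norm_le_const (a := 0) (b := 2 * Real.pi)
    (f := fun t => ((t - Real.pi : ℝ) : ℂ) • rotate M t O) (C := Real.pi * ‖O‖) fun t ht => by
      rw [Set.uIoc_of_le (by positivity)] at ht
      rw [norm_smul, norm_rotate hM, norm_real, Real.norm_eq_abs]
      gcongr
      rw [abs_le]; constructor <;> linarith [ht.1, ht.2]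
  rw [sub_zero, abs_of_pos (by positivity)] at h
  rw [rotSawtooth, norm_smul]
  simp only [norm_inv, norm_mul, norm_real, Real.norm_eq_abs, abs_of_pos hp, Complex.norm_ofNat]
  rw [inv_mul_le_iff₀ (by positivity)]
  linarith

lemma commutator_integral (M : 𝔄) {f : ℝ → 𝔄} (hf : Continuous f) (a b : ℝ) :
    ∫ t in a..b, (M * f t - f t * M) = M * (∫ t in a..b, f t) - (∫ t in a..b, f t) * M := by
  have := ((ContinuousLinearMap.mul ℂ 𝔄 M) - (ContinuousLinearMap.mul ℂ 𝔄).flip M)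
    |>.intervalIntegral_comp_comm (hf.intervalIntegrable (μ := volume) a b)
  simpa using this

/-- The integral of `i[M, ·]` along the orbit is the difference of the endpoints of a closed orbit.
-/
lemma commute_rotAverage {M : 𝔄} (h : propagator M (2 * Real.pi) = 1) (O : 𝔄) :
    Commute M (rotAverage M O) := by
  have hc := continuous_rotate M O
  have h1 := intervalIntegral.integral_eq_sub_of_hasDerivAt
    (fun t _ => hasDerivAt_rotate M O t)
    ((((continuous_const.mul hc).sub (hc.mul continuous_const)).const_smul I).intervalIntegrable
      0 (2 * Real.pi))
  rw [rotate_two_pi h, intervalIntegral.integral_smul, commutator_integral M hc] at h1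
  have h2 : rotate M 0 O = O := by simp [rotate]
  rw [h2, sub_self, smul_eq_zero_iff_right I_ne_zero, sub_eq_zero] at h1
  exact (show Commute M _ from h1).smul_right _

/-- Integration by parts: the sawtooth has derivative `1`, which produces the average, and by
periodicity its jump of `2π` produces the boundary term `2π O`. -/
lemma commutator_rotSawtooth {M : 𝔄} (h : propagator M (2 * Real.pi) = 1) (O : 𝔄) :
    I • (M * rotSawtooth M O - rotSawtooth M O * M) = O - rotAverage M O := by
  have hc := continuous_rotate M O
  have hu : ∀ t : ℝ, HasDerivAt (fun t : ℝ => ((t - Real.pi : ℝ) : ℂ)) 1 t := fun t => by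
    simpa using ((hasDerivAt_id t).sub_const Real.pi).ofReal_comp
  have hd : Continuous fun t : ℝ => ((t - Real.pi : ℝ) : ℂ) := by fun_prop
  have h1 := intervalIntegral.integral_eq_sub_of_hasDerivAt
    (fun t _ => (hu t).smul (hasDerivAt_rotate M O t))
    (((hd.smul (((continuous_const.mul hc).sub (hc.mul continuous_const)).const_smul I)).add
      (continuous_const.smul hc)).intervalIntegrable 0 (2 * Real.pi))
  have h2 : rotate M 0 O = O := by simp [rotate]
  have h3 : ∀ t : ℝ, ((t - Real.pi : ℝ) : ℂ) • I • (M * rotate M t O - rotate M t O * M)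
      = I • (M * (((t - Real.pi : ℝ) : ℂ) • rotate M t O)
        - (((t - Real.pi : ℝ) : ℂ) • rotate M t O) * M) := fun t => by
    simp only [mul_smul_comm, smul_mul_assoc, ← smul_sub]
    rw [smul_comm]
  simp only [h3, one_smul] at h1
  rw [intervalIntegral.integral_add, intervalIntegral.integral_smul,
    commutator_integral M (f := fun t : ℝ => ((t - Real.pi : ℝ) : ℂ) • rotate M t O) (hd.smul hc),
    Pi.smul_apply', Pi.smul_apply', rotate_two_pi h, h2] at h1
  · have h4 : ((2 * Real.pi - Real.pi : ℝ) : ℂ) • O - ((0 - Real.pi : ℝ) : ℂ) • O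
        = (2 * Real.pi : ℂ) • O := by
      rw [← sub_smul]; congr 1; push_cast; ring
    rw [h4, ← eq_sub_iff_add_eq] at h1
    simp only [rotSawtooth, rotAverage, mul_smul_comm, smul_mul_assoc, ← smul_sub]
    rw [smul_comm, h1, smul_sub, two_pi_smul_cancel]
  · exact ((((continuous_const.mul (hd.smul hc)).sub
      ((hd.smul hc).mul continuous_const)).const_smul I)).intervalIntegrable _ _
  · exact hc.intervalIntegrable _ _

lemma star_rotAverage {M : 𝔄} (hM : IsSelfAdjoint M) (O : 𝔄) :
    star (rotAverage M O) = rotAverage M (star O) := by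
  have := (starL' ℝ (A := 𝔄)).toContinuousLinearMap.intervalIntegral_comp_comm
    ((continuous_rotate M O).intervalIntegrable (μ := volume) 0 (2 * Real.pi))
  simp only [ContinuousLinearEquiv.coe_coe, starL'_apply, star_rotate hM] at this
  simp [rotAverage, this]

lemma star_rotSawtooth {M : 𝔄} (hM : IsSelfAdjoint M) (O : 𝔄) :
    star (rotSawtooth M O) = rotSawtooth M (star O) := by
  have hd : Continuous fun t : ℝ => ((t - Real.pi : ℝ) : ℂ) := by fun_prop
  have := (starL' ℝ (A := 𝔄)).toContinuousLinearMap.intervalIntegral_comp_comm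
    ((hd.smul (continuous_rotate M O)).intervalIntegrable (μ := volume) 0 (2 * Real.pi))
  simp only [ContinuousLinearEquiv.coe_coe, starL'_apply, Pi.smul_apply', star_rotate hM, star_smul,
    RCLike.star_def, conj_ofReal] at this
  rw [rotSawtooth, star_smul, ← this]
  simp [rotSawtooth]

/-- The integrand vanishes in the quotient by `p`, which is a normed space because `p` is closed. -/
lemma intervalIntegral_mem {E : Type*} [NormedAddCommGroup E] [NormedSpace ℂ E] [CompleteSpace E]
    (p : Submodule ℂ E) (hp : IsClosed (p : Set E)) {f : ℝ → E} (hf : Continuous f)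
    (h : ∀ t, f t ∈ p) (a b : ℝ) : ∫ t in a..b, f t ∈ p := by
  have _ : IsClosed (p : Set E) := hp
  have := p.mkQL.intervalIntegral_comp_comm (hf.intervalIntegrable (μ := volume) a b)
  have h0 : ∀ t, p.mkQL (f t) = 0 := fun t => (Submodule.Quotient.mk_eq_zero p).2 (h t)
  simp only [h0, intervalIntegral.integral_zero] at this
  exact (Submodule.Quotient.mk_eq_zero p).1 this.symm

lemma rotAverage_mem {M O : 𝔄} (p : Submodule ℂ 𝔄) (hp : IsClosed (p : Set 𝔄))
    (h : ∀ t, rotate M t O ∈ p) : rotAverage M O ∈ p :=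
  p.smul_mem _ (intervalIntegral_mem p hp (continuous_rotate M O) h _ _)

lemma rotSawtooth_mem {M O : 𝔄} (p : Submodule ℂ 𝔄) (hp : IsClosed (p : Set 𝔄))
    (h : ∀ t, rotate M t O ∈ p) : rotSawtooth M O ∈ p := by
  have hd : Continuous fun t : ℝ => ((t - Real.pi : ℝ) : ℂ) := by fun_prop
  exact p.smul_mem _ (intervalIntegral_mem p hp (hd.smul (continuous_rotate M O))
    (fun t => p.smul_mem _ (h t)) _ _)

/-- Termwise in the exponential series, since `M ^ k * P = a ^ k • P`. It is applied with `P` a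
spectral projection of `M`. -/
lemma exp_smul_mul_of_mul_eq {M P : 𝔄} {a : ℂ} (h : M * P = a • P) (t : ℝ) :
    propagator M t * P = Complex.exp (t * I * a) • P := by
  have h1 := (NormedSpace.exp_series_hasSum_exp' (𝕂 := ℂ) ((t : ℂ) • (I • M))).mul_right P
  have h2 := (NormedSpace.exp_series_hasSum_exp' (𝕂 := ℂ) (t * I * a)).smul_const P
  rw [← Complex.exp_eq_exp_ℂ] at h2
  have hk : ∀ k : ℕ, M ^ k * P = a ^ k • P := fun k => by
    induction k with
    | zero => simp
    | succ k ih => rw [pow_succ, mul_assoc, h, mul_smul_comm, ih, smul_smul, pow_succ, mul_comm a]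
  refine h1.unique ?_
  have h3 : (fun k : ℕ => ((k.factorial : ℂ)⁻¹ • ((t : ℂ) • (I • M)) ^ k) * P)
      = fun k : ℕ => ((k.factorial : ℂ)⁻¹ • (t * I * a) ^ k) • P := by
    funext k
    simp only [smul_pow, smul_mul_assoc, hk, smul_smul, mul_pow, smul_eq_mul]
    congr 1
    ring
  rwa [h3]

lemma propagator_add_of_commute {M P : 𝔄} (h : Commute M P) (t : ℝ) :
    propagator (M + P) t = propagator M t * propagator P t := by
  let _ : NormedAlgebra ℚ 𝔄 := NormedAlgebra.restrictScalars ℚ ℂ 𝔄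
  rw [propagator, propagator, propagator, ← NormedSpace.exp_add_of_commute]
  · rw [smul_add, smul_add]
  · exact (((h.smul_left _).smul_left _).smul_right _).smul_right _

/-- The source of locality: the part of the generator that commutes with everything in sight cancels
from the conjugation. -/
lemma rotate_add_of_commute {M P O : 𝔄} (h : Commute M P) (hO : Commute P O) (t : ℝ) :
    rotate (M + P) t O = rotate M t O := by
  have h1 : propagator (M + P) t = propagator M t * propagator P t := propagator_add_of_commute h t
  have h2 : propagator (M + P) (-t) = propagator P (-t) * propagator M (-t) := by
    rw [add_comm, propagator_add_of_commute h.symm]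
  rw [rotate, rotate, h1, h2]
  calc _ = propagator M t * rotate P t O * propagator M (-t) := by simp only [rotate, mul_assoc]
    _ = _ := by rw [rotate_of_commute hO]

lemma exp_mem_of_isClosed (B : Subalgebra ℂ 𝔄) (hB : IsClosed (B : Set 𝔄)) {a : 𝔄} (ha : a ∈ B) :
    NormedSpace.exp a ∈ B :=
  hB.mem_of_tendsto (NormedSpace.exp_series_hasSum_exp' (𝕂 := ℂ) a) <| .of_forall fun _ =>
    B.sum_mem fun _ _ => B.smul_mem (B.pow_mem ha _) _

lemma propagator_mem {M : 𝔄} (B : Subalgebra ℂ 𝔄) (hB : IsClosed (B : Set 𝔄)) (hM : M ∈ B)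
    (t : ℝ) : propagator M t ∈ B :=
  exp_mem_of_isClosed B hB (B.smul_mem (B.smul_mem hM _) _)

lemma rotate_mem {M O : 𝔄} (B : Subalgebra ℂ 𝔄) (hB : IsClosed (B : Set 𝔄)) (hM : M ∈ B)
    (hO : O ∈ B) (t : ℝ) : rotate M t O ∈ B :=
  B.mul_mem (B.mul_mem (propagator_mem B hB hM t) hO) (propagator_mem B hB hM (-t))

end Rotation

namespace SpinSystem

/-! ### Operators acting within a set of sites. -/

section Locality

open Kronecker

variable {d : ℕ} {Λ : Finset (Fin d → ℤ)} {q : ℕ}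

/-- The splitting of a configuration into its restrictions to `S` and to the complement of `S`. -/
noncomputable def splitConfig (q : ℕ) (S : Finset Λ) :
    (Λ → Fin q) ≃ (S → Fin q) × ({x // x ∉ S} → Fin q) :=
  Equiv.piEquivPiSubtypeProd (· ∈ S) fun _ => Fin q

/-- Writing the operator as a reindexed Kronecker product reduces closure under multiplication to
the mixed-product rule. -/
lemma actsWithin_iff {S : Finset Λ} {O : Op Λ q} :
    ActsWithin S O ↔ ∃ B : Matrix (S → Fin q) (S → Fin q) ℂ,
      O = (B ⊗ₖ (1 : Matrix ({x // x ∉ S} → Fin q) _ ℂ)).submatrix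
        (splitConfig q S) (splitConfig q S) := by
  refine exists_congr fun B => ?_
  rw [← Matrix.ext_iff]
  refine forall_congr' fun σ => forall_congr' fun τ => ?_
  simp [splitConfig, Equiv.piEquivPiSubtypeProd, Matrix.one_apply, funext_iff]

lemma ActsWithin.smul {S : Finset Λ} {O : Op Λ q} (c : ℂ) (h : ActsWithin S O) :
    ActsWithin S (c • O) := by
  obtain ⟨B, hB⟩ := h
  refine ⟨c • B, fun σ τ => ?_⟩
  rw [Matrix.smul_apply, hB]; split_ifs <;> simp

lemma ActsWithin.add {S : Finset Λ} {O P : Op Λ q} (h : ActsWithin S O) (h' : ActsWithin S P) :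
    ActsWithin S (O + P) := by
  obtain ⟨B, hB⟩ := h
  obtain ⟨B', hB'⟩ := h'
  refine ⟨B + B', fun σ τ => ?_⟩
  rw [Matrix.add_apply, hB, hB']; split_ifs <;> simp

lemma ActsWithin.mul {S : Finset Λ} {O P : Op Λ q} (h : ActsWithin S O) (h' : ActsWithin S P) :
    ActsWithin S (O * P) := by
  obtain ⟨B, rfl⟩ := actsWithin_iff.1 h
  obtain ⟨B', rfl⟩ := actsWithin_iff.1 h'
  refine actsWithin_iff.2 ⟨B * B', ?_⟩
  rw [Matrix.submatrix_mul_equiv, ← Matrix.mul_kronecker_mul, one_mul]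

lemma actsWithin_one (S : Finset Λ) : ActsWithin S (1 : Op Λ q) := by
  refine actsWithin_iff.2 ⟨1, ?_⟩
  rw [Matrix.one_kronecker_one, Matrix.submatrix_one_equiv]

/-- The algebra of the operators acting within `S`. -/
def localAlgebra (q : ℕ) (S : Finset Λ) : Subalgebra ℂ (Op Λ q) where
  carrier := {O | ActsWithin S O}
  mul_mem' := ActsWithin.mul
  add_mem' := ActsWithin.add
  algebraMap_mem' c := by
    rw [Algebra.algebraMap_eq_smul_one]
    exact (actsWithin_one S).smul c

lemma isClosed_localAlgebra (S : Finset Λ) : IsClosed (localAlgebra q S : Set (Op Λ q)) :=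
  (Subalgebra.toSubmodule (localAlgebra q S)).closed_of_finiteDimensional

lemma actsWithin_zero (S : Finset Λ) : ActsWithin S (0 : Op Λ q) := (localAlgebra q S).zero_mem

lemma ActsWithin.sub {S : Finset Λ} {O P : Op Λ q} (h : ActsWithin S O) (h' : ActsWithin S P) :
    ActsWithin S (O - P) := (localAlgebra q S).sub_mem h h'

lemma ActsWithin.mono {S T : Finset Λ} (hST : S ⊆ T) {O : Op Λ q} (h : ActsWithin S O) :
    ActsWithin T O := by
  classical
  obtain ⟨B, hB⟩ := h
  refine ⟨Matrix.of fun σ τ => if ∀ x : T, x.1 ∉ S → σ x = τ x then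
    B (fun x => σ ⟨x, hST x.2⟩) (fun x => τ ⟨x, hST x.2⟩) else 0, fun σ τ => ?_⟩
  rw [hB, Matrix.of_apply]
  by_cases h1 : ∀ x, x ∉ S → σ x = τ x
  · rw [if_pos h1, if_pos fun x hx => h1 x fun hS => hx (hST hS)]
    exact (if_pos fun x : T => h1 x).symm
  · rw [if_neg h1]
    by_cases h2 : ∀ x, x ∉ T → σ x = τ x
    · rw [if_pos h2, if_neg]
      exact fun h3 => h1 fun x hx => if hT : x ∈ T then h3 ⟨x, hT⟩ hx else h2 x hT
    · rw [if_neg h2]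

/-- Relative to the splitting of the sites along `S`, the two operators are `B ⊗ 1` and `1 ⊗ C'`. -/
lemma ActsWithin.commute {S T : Finset Λ} (hST : Disjoint S T) {O P : Op Λ q}
    (hO : ActsWithin S O) (hP : ActsWithin T P) : Commute O P := by
  classical
  obtain ⟨B, rfl⟩ := actsWithin_iff.1 hO
  obtain ⟨C, hC⟩ := hP
  have hS : ∀ x ∈ T, x ∉ S := fun x hx hx' => Finset.disjoint_left.1 hST hx' hx
  obtain ⟨C', rfl⟩ : ∃ C' : Matrix ({x // x ∉ S} → Fin q) ({x // x ∉ S} → Fin q) ℂ,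
      P = ((1 : Matrix (S → Fin q) _ ℂ) ⊗ₖ C').submatrix
        (splitConfig q S) (splitConfig q S) := by
    refine ⟨Matrix.of fun σ τ => if ∀ x : {x // x ∉ S}, x.1 ∉ T → σ x = τ x then
        C (fun x => σ ⟨x, hS x x.2⟩) (fun x => τ ⟨x, hS x x.2⟩) else 0, ?_⟩
    ext σ τ
    rw [hC, Matrix.submatrix_apply, Matrix.kronecker_apply, Matrix.one_apply, Matrix.of_apply]
    simp only [splitConfig, Equiv.piEquivPiSubtypeProd, Equiv.coe_fn_mk, funext_iff, ite_mul,
      one_mul, zero_mul]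
    by_cases h1 : ∀ x, x ∉ T → σ x = τ x
    · rw [if_pos h1, if_pos fun x : {x // x ∈ S} => h1 x (Finset.disjoint_left.1 hST x.2)]
      exact (if_pos fun x : {x // x ∉ S} => h1 x).symm
    · rw [if_neg h1]
      by_cases h2 : ∀ x : {x // x ∈ S}, σ x = τ x
      · rw [if_pos h2, if_neg]
        exact fun h3 => h1 fun x hx => if hS' : x ∈ S then h2 ⟨x, hS'⟩ else h3 ⟨x, hS'⟩ hx
      · rw [if_neg h2]
  rw [Commute, SemiconjBy, Matrix.submatrix_mul_equiv, Matrix.submatrix_mul_equiv,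
    ← Matrix.mul_kronecker_mul, ← Matrix.mul_kronecker_mul]
  simp

end Locality

/-! ### The number operator: spectral projections, periodicity and locality of its flow. -/

section NumberOperator

open Complex

variable {d : ℕ} {Λ : Finset (Fin d → ℤ)} {q : ℕ}

lemma mul_specProj {M : Op Λ q} (hM : M.IsHermitian) (n : ℤ) :
    M * specProj M n = (n : ℂ) • specProj M n := by
  have hM' : IsSelfAdjoint M := hM
  have hfin : ∀ f : ℝ → ℝ, ContinuousOn f (spectrum ℝ M) := fun f =>
    (Matrix.finite_real_spectrum (A := M)).continuousOn f
  have h1 : M * specProj M n = cfc (fun x : ℝ => x * Set.indicator {(n : ℝ)} (fun _ => 1) x) M := by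
    rw [cfc_mul _ _ _ (hfin _) (hfin _), specProj, cfc_id' ℝ M]
  have h2 : (fun x : ℝ => x * Set.indicator {(n : ℝ)} (fun _ => (1 : ℝ)) x)
      = fun x => (n : ℝ) • Set.indicator {(n : ℝ)} (fun _ => (1 : ℝ)) x := by
    funext x
    by_cases hx : x = n <;> simp [hx]
  rw [h1, h2, cfc_smul _ _ _ (hfin _), specProj]
  ext i j
  simp

/-- `F` consists of the rounded points of the finite spectrum. Integrality makes the indicators of
the points of `F` add up to `1` on the spectrum, and functional calculus transfers this to
projections. -/
lemma exists_resolution {M : Op Λ q} (hM : M.IsHermitian)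
    (hs : ∀ x ∈ spectrum ℝ M, ∃ n : ℤ, (n : ℝ) = x) :
    ∃ F : Finset ℤ, (∀ n ∉ F, specProj M n = 0) ∧ ∑ n ∈ F, specProj M n = 1 := by
  classical
  have hM' : IsSelfAdjoint M := hM
  have hfin : ∀ f : ℝ → ℝ, ContinuousOn f (spectrum ℝ M) := fun f =>
    (Matrix.finite_real_spectrum (A := M)).continuousOn f
  have hF : ∀ x ∈ spectrum ℝ M,
      round x ∈ (Matrix.finite_real_spectrum (A := M)).toFinset.image round := fun x hx =>
    Finset.mem_image_of_mem _ (by simpa using hx)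
  refine ⟨(Matrix.finite_real_spectrum (A := M)).toFinset.image round, fun n hn => ?_, ?_⟩
  · rw [specProj, ← cfc_zero ℝ M]
    refine cfc_congr fun x hx => ?_
    rw [Set.indicator_of_notMem]
    · rfl
    · rintro rfl
      exact hn (by simpa using hF _ hx)
  · simp only [specProj]
    rw [← cfc_sum _ _ _ (fun i _ => hfin _), ← cfc_one ℝ M]
    refine cfc_congr fun x hx => ?_
    obtain ⟨m, rfl⟩ := hs x hx
    have hm := hF _ hx
    rw [round_intCast] at hm
    simp only [Finset.sum_apply, Set.indicator_apply, Set.mem_singleton_iff, Int.cast_inj]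
    rw [Finset.sum_ite_eq, if_pos hm]
    rfl

lemma propagator_eq_sum {M : Op Λ q} (hM : M.IsHermitian) {F : Finset ℤ}
    (hF : ∑ n ∈ F, specProj M n = 1) (t : ℝ) :
    propagator M t = ∑ n ∈ F, Complex.exp (t * I * n) • specProj M n := by
  rw [← mul_one (propagator M t), ← hF, Finset.mul_sum]
  exact Finset.sum_congr rfl fun n _ => exp_smul_mul_of_mul_eq (mul_specProj hM n) t

lemma exp_two_pi_mul_int (n : ℤ) : Complex.exp ((2 * Real.pi : ℝ) * I * n) = 1 :=
  Complex.exp_eq_one_iff.2 ⟨n, by push_cast; ring⟩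

lemma propagator_two_pi {M : Op Λ q} (hM : M.IsHermitian)
    (hs : ∀ x ∈ spectrum ℝ M, ∃ n : ℤ, (n : ℝ) = x) : propagator M (2 * Real.pi) = 1 := by
  obtain ⟨F, -, hF⟩ := exists_resolution hM hs
  rw [propagator_eq_sum hM hF]
  simp only [exp_two_pi_mul_int, one_smul, hF]

/-- Spectral mapping and `e^{2πix} = 1`. This direction gives integrality of the spectrum of the
total `N` from the product of the on-site propagators, with no joint diagonalization. -/
lemma spectrum_int_of_propagator {M : Op Λ q} (h : propagator M (2 * Real.pi) = 1) :
    ∀ x ∈ spectrum ℝ M, ∃ n : ℤ, (n : ℝ) = x := by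
  intro x hx
  rcases subsingleton_or_nontrivial (Op Λ q) with hs | hs
  · simp at hx
  have h1 : (x : ℂ) ∈ spectrum ℂ M := by
    simpa using (spectrum.algebraMap_mem_iff ℂ (R := ℝ) (a := M) (r := x)).2 hx
  have hc : ((2 * Real.pi : ℝ) : ℂ) * I ≠ 0 := by simp [Real.pi_ne_zero]
  have h2 : (((2 * Real.pi : ℝ) : ℂ) * I) • (x : ℂ)
      ∈ spectrum ℂ ((((2 * Real.pi : ℝ) : ℂ) * I) • M) :=
    (spectrum.smul_mem_smul_iff (r := Units.mk0 _ hc)).2 h1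
  have h3 := spectrum.exp_mem_exp _ h2
  rw [mul_smul _ _ M] at h3
  change _ ∈ spectrum ℂ (propagator M (2 * Real.pi)) at h3
  rw [h, spectrum.one_eq, Set.mem_singleton_iff, ← Complex.exp_eq_exp_ℂ] at h3
  obtain ⟨n, hn⟩ := Complex.exp_eq_one_iff.1 h3
  refine ⟨n, ?_⟩
  have h4 : (((2 * Real.pi : ℝ) : ℂ) * I) * x = (((2 * Real.pi : ℝ) : ℂ) * I) * n := by
    rw [← smul_eq_mul, hn]; push_cast; ring
  exact_mod_cast (mul_left_cancel₀ hc h4).symm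

lemma integral_exp_int (m n : ℤ) :
    ∫ t in (0 : ℝ)..2 * Real.pi, Complex.exp (t * I * m) * Complex.exp ((-t : ℝ) * I * n)
      = if m = n then (2 * Real.pi : ℂ) else 0 := by
  have h : ∀ t : ℝ, Complex.exp (t * I * m) * Complex.exp ((-t : ℝ) * I * n)
      = Complex.exp ((I * ((m - n : ℤ) : ℂ)) * t) := fun t => by
    rw [← Complex.exp_add]; congr 1; push_cast; ring
  simp only [h]
  split_ifs with hmn
  · simp [hmn]
  · have h0 : I * ((m - n : ℤ) : ℂ) ≠ 0 :=
      mul_ne_zero I_ne_zero (Int.cast_ne_zero.2 (sub_ne_zero.2 hmn))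
    have h1 := exp_two_pi_mul_int (m - n)
    rw [integral_exp_mul_complex h0, show I * ((m - n : ℤ) : ℂ) * ((2 * Real.pi : ℝ) : ℂ)
      = ((2 * Real.pi : ℝ) : ℂ) * I * ((m - n : ℤ) : ℂ) by ring, h1]
    simp

/-- The block between the projections `m` and `n` rotates with phase `e^{it(m-n)}`, so orthogonality
of the exponentials leaves only `m = n`. -/
lemma diagPart_eq_rotAverage {N : Λ → Op Λ q} (hN : (∑ x, N x).IsHermitian)
    (hs : ∀ x ∈ spectrum ℝ (∑ x, N x), ∃ n : ℤ, (n : ℝ) = x) (O : Op Λ q) :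
    diagPart N O = rotAverage (∑ x, N x) O := by
  obtain ⟨F, hF0, hF⟩ := exists_resolution hN hs
  have h1 : diagPart N O = ∑ n ∈ F, specProj (∑ x, N x) n * O * specProj (∑ x, N x) n := by
    refine finsum_eq_sum_of_support_subset _ fun n hn => ?_
    by_contra hn'
    exact hn (by beta_reduce; rw [hF0 n hn', mul_zero])
  have h2 : ∀ t, rotate (∑ x, N x) t O = ∑ m ∈ F, ∑ n ∈ F,
      (Complex.exp (t * I * m) * Complex.exp ((-t : ℝ) * I * n)) •
        (specProj (∑ x, N x) m * O * specProj (∑ x, N x) n) := fun t => by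
    rw [rotate, propagator_eq_sum hN hF, propagator_eq_sum hN hF, Finset.sum_mul, Finset.sum_mul]
    refine Finset.sum_congr rfl fun m _ => ?_
    rw [Finset.mul_sum]
    refine Finset.sum_congr rfl fun n _ => ?_
    rw [smul_mul_assoc, smul_mul_assoc, mul_smul_comm, smul_smul]
  have hc : ∀ (m n : ℤ) (X : Op Λ q), Continuous fun t : ℝ =>
      (Complex.exp (t * I * m) * Complex.exp ((-t : ℝ) * I * n)) • X := fun m n X => by fun_prop
  simp only [rotAverage, h2]
  rw [intervalIntegral.integral_finsetSum fun m _ =>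
    (continuous_finsetSum _ fun n _ => hc m n _).intervalIntegrable _ _, h1, Finset.smul_sum]
  refine Finset.sum_congr rfl fun m hm => ?_
  rw [intervalIntegral.integral_finsetSum fun n _ => (hc m n _).intervalIntegrable _ _]
  simp only [intervalIntegral.integral_smul_const, integral_exp_int, ite_smul, zero_smul]
  rw [Finset.sum_ite_eq, if_pos hm, two_pi_smul_cancel]

section NumberFamily

variable {N : Λ → Op Λ q}

lemma IsNumberFamily.commute (hN : IsNumberFamily N) (x y : Λ) : Commute (N x) (N y) := by
  by_cases h : x = y
  · rw [h]
  · exact (hN x).1.commute (by simpa using h) (hN y).1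

lemma IsNumberFamily.isHermitian_sum (hN : IsNumberFamily N) (s : Finset Λ) :
    (∑ x ∈ s, N x).IsHermitian :=
  isSelfAdjoint_sum s fun x _ => (hN x).2.1

lemma IsNumberFamily.commute_sum (hN : IsNumberFamily N) {S s : Finset Λ} (h : Disjoint S s)
    {O : Op Λ q} (hO : ActsWithin S O) : Commute (∑ x ∈ s, N x) O :=
  Commute.sum_left _ _ _ fun x hx => ((hN x).1.commute
    (Finset.disjoint_singleton_left.2 fun hS => Finset.disjoint_left.1 h hS hx) hO)

lemma IsNumberFamily.spectrum_real (hN : IsNumberFamily N) (x : Λ) :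
    ∀ r ∈ spectrum ℝ (N x), ∃ n : ℤ, (n : ℝ) = r := by
  intro r hr
  obtain ⟨n, hn⟩ := (hN x).2.2 ((spectrum.algebraMap_mem_iff ℂ (R := ℝ)).2 hr)
  exact ⟨n, by simpa using congrArg Complex.re hn⟩

lemma IsNumberFamily.propagator_sum (hN : IsNumberFamily N) (s : Finset Λ) :
    propagator (∑ x ∈ s, N x) (2 * Real.pi) = 1 := by
  classical
  induction s using Finset.induction_on with
  | empty => simp [propagator]
  | insert x s hx ih =>
    rw [Finset.sum_insert hx, propagator_add_of_commute, ih,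
      propagator_two_pi (hN x).2.1 (hN.spectrum_real x), one_mul]
    exact (Commute.sum_left _ _ _ fun y _ => hN.commute y x).symm

lemma IsNumberFamily.diagPart_eq (hN : IsNumberFamily N) (O : Op Λ q) :
    diagPart N O = rotAverage (∑ x, N x) O :=
  diagPart_eq_rotAverage (hN.isHermitian_sum _)
    (spectrum_int_of_propagator (hN.propagator_sum _)) O

/-- Only the `N x` with `x ∈ S` contribute; the rest commutes with them and with `O`. -/
lemma IsNumberFamily.actsWithin_rotate (hN : IsNumberFamily N) {S : Finset Λ} {O : Op Λ q}
    (hO : ActsWithin S O) (t : ℝ) : ActsWithin S (rotate (∑ x, N x) t O) := by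
  classical
  rw [← Finset.sum_add_sum_compl S N, rotate_add_of_commute
    (Commute.sum_left _ _ _ fun x _ => Commute.sum_right _ _ _ fun y _ => hN.commute x y)
    (hN.commute_sum disjoint_compl_right hO)]
  exact rotate_mem (localAlgebra q S) (isClosed_localAlgebra S)
    (sum_mem fun x hx => (hN x).1.mono (Finset.singleton_subset_iff.2 hx)) hO t

lemma IsNumberFamily.actsWithin_diagPart (hN : IsNumberFamily N) {S : Finset Λ} {O : Op Λ q}
    (hO : ActsWithin S O) : ActsWithin S (diagPart N O) := by
  rw [hN.diagPart_eq]
  exact rotAverage_mem (Subalgebra.toSubmodule (localAlgebra q S)) (isClosed_localAlgebra S)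
    fun t => hN.actsWithin_rotate hO t

lemma IsNumberFamily.actsWithin_rotSawtooth (hN : IsNumberFamily N) {S : Finset Λ} {O : Op Λ q}
    (hO : ActsWithin S O) : ActsWithin S (rotSawtooth (∑ x, N x) O) :=
  rotSawtooth_mem (Subalgebra.toSubmodule (localAlgebra q S)) (isClosed_localAlgebra S)
    fun t => hN.actsWithin_rotate hO t

end NumberFamily

end NumberOperator

end SpinSystem

/-! ### The exponential of a commutator as a conjugation. -/

section ExpAd

variable {𝔄 : Type*} [CStarAlgebra 𝔄]

lemma hasSum_exp_apply {E : Type*} [NormedAddCommGroup E] [NormedSpace ℂ E] [CompleteSpace E]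
    (T : E →L[ℂ] E) (z : E) :
    HasSum (fun k : ℕ => (k.factorial : ℂ)⁻¹ • (T : E → E)^[k] z) (NormedSpace.exp T z) := by
  have h := (ContinuousLinearMap.apply ℂ E z).hasSum
    (NormedSpace.exp_series_hasSum_exp' (𝕂 := ℂ) T)
  simpa [Function.comp_def, FunLike.coe_pow_eq_iterate] using h

/-- The commutator is left minus right multiplication by `q`. These two commute, so the exponential
factorizes. -/
lemma hasSum_commutator_iterate (q z : 𝔄) :
    HasSum (fun k : ℕ => (k.factorial : ℂ)⁻¹ • (fun w => q * w - w * q)^[k] z)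
      (NormedSpace.exp q * z * NormedSpace.exp (-q)) := by
  let _ : NormedAlgebra ℚ (𝔄 →L[ℂ] 𝔄) := NormedAlgebra.restrictScalars ℚ ℂ _
  have hL : ∀ w, NormedSpace.exp (ContinuousLinearMap.mul ℂ 𝔄 q) w = NormedSpace.exp q * w := by
    intro w
    have h1 := hasSum_exp_apply (ContinuousLinearMap.mul ℂ 𝔄 q) w
    have h2 := (NormedSpace.exp_series_hasSum_exp' (𝕂 := ℂ) q).mul_right w
    refine h1.unique ?_
    convert! h2 using 2 with k
    rw [smul_mul_assoc]
    congr 1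
    induction k with
    | zero => simp
    | succ k ih => rw [Function.iterate_succ_apply', ih, pow_succ']; simp [mul_assoc]
  have hR : ∀ w, NormedSpace.exp (-(ContinuousLinearMap.mul ℂ 𝔄).flip q) w
      = w * NormedSpace.exp (-q) := by
    intro w
    have h1 := hasSum_exp_apply (-(ContinuousLinearMap.mul ℂ 𝔄).flip q) w
    have h2 := (NormedSpace.exp_series_hasSum_exp' (𝕂 := ℂ) (-q)).mul_left w
    refine h1.unique ?_
    convert! h2 using 2 with k
    rw [mul_smul_comm]
    congr 1
    induction k with
    | zero => simp
    | succ k ih => rw [Function.iterate_succ_apply', ih, pow_succ]; simp [mul_assoc]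
  have hc : Commute (ContinuousLinearMap.mul ℂ 𝔄 q) (-(ContinuousLinearMap.mul ℂ 𝔄).flip q) := by
    refine Commute.neg_right ?_
    ext w
    simp [mul_assoc]
  have h := hasSum_exp_apply
    (ContinuousLinearMap.mul ℂ 𝔄 q + -(ContinuousLinearMap.mul ℂ 𝔄).flip q) z
  rw [NormedSpace.exp_add_of_commute hc, mul_apply_eq_comp, hR, hL, ← mul_assoc] at h
  have hf : (fun w => q * w - w * q)
      = ⇑(ContinuousLinearMap.mul ℂ 𝔄 q + -(ContinuousLinearMap.mul ℂ 𝔄).flip q) := by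
    funext w; simp [sub_eq_add_neg]
  simpa only [hf] using h

end ExpAd

namespace SpinSystem

variable {d : ℕ} {Λ : Finset (Fin d → ℤ)} {q : ℕ}

/-! ### Algebra of potentials: commutators, their exponentials and the associated operators. -/

section Potentials

lemma isConnectedSet_singleton (x : Λ) : IsConnectedSet ({x} : Finset Λ) := by
  have : Subsingleton (Subtype.val '' ((({x} : Finset Λ)) : Set Λ) : Set (Fin d → ℤ)) := by
    simp
  have : Nonempty (Subtype.val '' ((({x} : Finset Λ)) : Set Λ) : Set (Fin d → ℤ)) := by
    simp
  exact { preconnected := .of_subsingleton }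

lemma IsConnectedSet.union {S T : Finset Λ} (hS : IsConnectedSet S) (hT : IsConnectedSet T)
    (h : ¬ Disjoint S T) : IsConnectedSet (S ∪ T) := by
  obtain ⟨x, hx, hx'⟩ := Finset.not_disjoint_iff.1 h
  have := SimpleGraph.induce_union_connected hS.preconnected hT.preconnected
    ⟨x.1, ⟨x, hx, rfl⟩, ⟨x, hx', rfl⟩⟩
  rw [IsConnectedSet, Finset.coe_union, Set.image_union]
  exact this

/-- The linear space of potentials. -/
def potentials (Λ : Finset (Fin d → ℤ)) (q : ℕ) : Submodule ℂ (Family Λ q) where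
  carrier := {Z | IsPotential Z}
  add_mem' h h' := ⟨fun S => (h.1 S).add (h'.1 S), fun S hS => by simp [h.2 S hS, h'.2 S hS]⟩
  zero_mem' := ⟨fun S => actsWithin_zero S, fun _ _ => rfl⟩
  smul_mem' c _ h := ⟨fun S => (h.1 S).smul c, fun S hS => by simp [h.2 S hS]⟩

lemma IsPotential.add {Z W : Family Λ q} (h : IsPotential Z) (h' : IsPotential W) :
    IsPotential (Z + W) := (potentials Λ q).add_mem h h'

lemma IsPotential.sub {Z W : Family Λ q} (h : IsPotential Z) (h' : IsPotential W) :
    IsPotential (Z - W) := (potentials Λ q).sub_mem h h'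

lemma IsPotential.smul {Z : Family Λ q} (c : ℂ) (h : IsPotential Z) :
    IsPotential (c • Z) := (potentials Λ q).smul_mem c h

lemma isPotential_zero : IsPotential (0 : Family Λ q) := (potentials Λ q).zero_mem

lemma isPotential_of_hasSum {f : ℕ → Family Λ q} {F : Family Λ q} (h : HasSum f F)
    (hf : ∀ k, IsPotential (f k)) : IsPotential F :=
  (show IsClosed (potentials Λ q : Set (Family Λ q)) from
    (potentials Λ q).closed_of_finiteDimensional).mem_of_tendsto h
      (.of_forall fun _ => (potentials Λ q).sum_mem fun k _ => hf k)

/-- Only overlapping connected sets contribute to a commutator. This keeps the unions connected and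
makes the norm estimate local. -/
lemma commutator_eq_zero {Q Z : Family Λ q} (hQ : IsPotential Q) (hZ : IsPotential Z)
    {S T : Finset Λ} (h : ¬ (IsConnectedSet S ∧ IsConnectedSet T ∧ ¬ Disjoint S T)) :
    Q S * Z T - Z T * Q S = 0 := by
  by_cases hS : IsConnectedSet S
  · by_cases hT : IsConnectedSet T
    · have hd : Disjoint S T := by tauto
      rw [((hQ.1 S).commute hd (hZ.1 T)).eq, sub_self]
    · simp [hZ.2 T hT]
  · simp [hQ.2 S hS]

lemma IsPotential.adPot {Q Z : Family Λ q} (hQ : IsPotential Q) (hZ : IsPotential Z) :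
    IsPotential (adPot Q Z) := by
  refine ⟨fun S => ?_, fun S hS => ?_⟩
  · refine (localAlgebra q S).sum_mem fun S₁ _ => (localAlgebra q S).sum_mem fun S₂ _ => ?_
    split_ifs with h
    · have h1 := (hQ.1 S₁).mono (h ▸ Finset.subset_union_left)
      have h2 := (hZ.1 S₂).mono (h ▸ Finset.subset_union_right)
      exact (h1.mul h2).sub (h2.mul h1)
    · exact actsWithin_zero S
  · refine Finset.sum_eq_zero fun S₁ _ => Finset.sum_eq_zero fun S₂ _ => ?_
    split_ifs with h
    · refine commutator_eq_zero hQ hZ fun h' => hS ?_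
      rw [← h]
      exact h'.1.union h'.2.1 h'.2.2
    · rfl

lemma IsPotential.adPot_iterate {Q Z : Family Λ q} (hQ : IsPotential Q) (hZ : IsPotential Z)
    (k : ℕ) : IsPotential ((SpinSystem.adPot Q)^[k] Z) := by
  induction k with
  | zero => exact hZ
  | succ k ih => rw [Function.iterate_succ_apply']; exact hQ.adPot ih

lemma isPotential_numPot {N : Λ → Op Λ q} (hN : IsNumberFamily N) : IsPotential (numPot N) := by
  refine ⟨fun S => (localAlgebra q S).sum_mem fun x _ => ?_,
    fun S hS => Finset.sum_eq_zero fun x _ => ?_⟩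
  · split_ifs with h
    · rw [h]; exact (hN x).1
    · exact actsWithin_zero S
  · rw [if_neg]
    rintro rfl
    exact hS (isConnectedSet_singleton x)

/-- The commutator of potentials with a fixed potential, as a linear map. -/
noncomputable def adMap (Q : Family Λ q) : Family Λ q →L[ℂ] Family Λ q :=
  LinearMap.toContinuousLinearMap
    { toFun := adPot Q
      map_add' := fun Z W => by
        funext S
        simp only [adPot, Pi.add_apply, ← Finset.sum_add_distrib]
        refine Finset.sum_congr rfl fun S₁ _ => Finset.sum_congr rfl fun S₂ _ => ?_
        split_ifs
        · noncomm_ring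
        · simp
      map_smul' := fun c Z => by
        funext S
        simp only [adPot, Pi.smul_apply, Finset.smul_sum, RingHom.id_apply]
        refine Finset.sum_congr rfl fun S₁ _ => Finset.sum_congr rfl fun S₂ _ => ?_
        split_ifs
        · simp [smul_sub]
        · simp }

lemma hasSum_expAd (Q Z : Family Λ q) :
    HasSum (fun k : ℕ => (k.factorial : ℂ)⁻¹ • (adPot Q)^[k] Z) (expAd Q Z) := by
  have h := hasSum_exp_apply (adMap Q) Z
  convert! h using 1
  funext S
  exact (Pi.hasSum.1 h S).tsum_eq

lemma expAd_add (Q Z W : Family Λ q) : expAd Q (Z + W) = expAd Q Z + expAd Q W := by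
  have h : ∀ Z, expAd Q Z = NormedSpace.exp (adMap Q) Z := fun Z =>
    (hasSum_expAd Q Z).unique (hasSum_exp_apply (adMap Q) Z)
  simp only [h, map_add]

lemma adPot_smul (Q : Family Λ q) (c : ℂ) (Z : Family Λ q) :
    adPot Q (c • Z) = c • adPot Q Z := map_smul (adMap Q) c Z

lemma adPot_neg (Q Z : Family Λ q) : adPot Q (-Z) = -adPot Q Z := map_neg (adMap Q) Z

lemma IsPotential.expAd {Q Z : Family Λ q} (hQ : IsPotential Q) (hZ : IsPotential Z) :
    IsPotential (expAd Q Z) :=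
  isPotential_of_hasSum (hasSum_expAd Q Z) fun k => (hQ.adPot_iterate hZ k).smul _

lemma expAd_zero (Z : Family Λ q) : expAd 0 Z = Z := by
  have h0 : ∀ W : Family Λ q, adPot 0 W = 0 := fun W => by funext S; simp [adPot]
  refine (hasSum_expAd 0 Z).unique ?_
  have h := hasSum_single (f := fun k : ℕ => (k.factorial : ℂ)⁻¹ • (adPot 0)^[k] Z) 0
    fun k hk => by
      obtain ⟨m, rfl⟩ := Nat.exists_eq_succ_of_ne_zero hk
      rw [Function.iterate_succ_apply', h0, smul_zero]
  simpa using h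

lemma toOp_adPot (Q Z : Family Λ q) :
    toOp (adPot Q Z) = toOp Q * toOp Z - toOp Z * toOp Q := by
  have h : ∀ S₁ : Finset Λ, ∑ S, ∑ S₂, (if S₁ ∪ S₂ = S then Q S₁ * Z S₂ - Z S₂ * Q S₁ else 0)
      = ∑ S₂, (Q S₁ * Z S₂ - Z S₂ * Q S₁) := fun S₁ => by
    rw [Finset.sum_comm]
    refine Finset.sum_congr rfl fun S₂ _ => ?_
    rw [Finset.sum_ite_eq, if_pos (Finset.mem_univ _)]
  simp only [toOp, adPot]
  rw [Finset.sum_comm, Finset.sum_congr rfl fun S₁ _ => h S₁]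
  simp only [Finset.sum_sub_distrib]
  rw [Finset.sum_mul_sum, Finset.sum_mul_sum]
  congr 1
  rw [Finset.sum_comm]

lemma toOp_expAd (Q Z : Family Λ q) :
    toOp (expAd Q Z) = NormedSpace.exp (toOp Q) * toOp Z * NormedSpace.exp (-toOp Q) := by
  have hc : Continuous (toOp : Family Λ q → Op Λ q) := by unfold toOp; fun_prop
  let T : Family Λ q →+ Op Λ q :=
    { toFun := toOp
      map_zero' := by simp [toOp]
      map_add' := fun Z W => by simp [toOp, Finset.sum_add_distrib] }
  have h1 := (hasSum_expAd Q Z).map T hc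
  refine h1.unique ?_
  convert! hasSum_commutator_iterate (toOp Q) (toOp Z) using 2 with k
  have hs : ∀ (c : ℂ) (W : Family Λ q), toOp (c • W) = c • toOp W := fun c W => by
    simp [toOp, Finset.smul_sum]
  change toOp _ = _
  rw [hs]
  congr 1
  induction k with
  | zero => rfl
  | succ k ih => rw [Function.iterate_succ_apply', Function.iterate_succ_apply', toOp_adPot, ih]

lemma IsHermitianFamily.adPot {Q Z : Family Λ q} (hQ : IsAntiHermitianFamily Q)
    (hZ : IsHermitianFamily Z) : IsHermitianFamily (adPot Q Z) := by
  intro S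
  refine isSelfAdjoint_sum _ fun S₁ _ => isSelfAdjoint_sum _ fun S₂ _ => ?_
  split_ifs
  · have h1 : star (Q S₁) = - Q S₁ := hQ S₁
    have h2 : star (Z S₂) = Z S₂ := hZ S₂
    rw [IsSelfAdjoint, star_sub, star_mul, star_mul, h1, h2]
    noncomm_ring
  · exact IsSelfAdjoint.zero _

lemma isHermitianFamily_expAd {Q Z : Family Λ q} (hQ : IsAntiHermitianFamily Q)
    (hZ : IsHermitianFamily Z) : IsHermitianFamily (expAd Q Z) := by
  intro S
  have h := Pi.hasSum.1 (hasSum_expAd Q Z) S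
  have hk : ∀ k, IsHermitianFamily ((SpinSystem.adPot Q)^[k] Z) := fun k => by
    induction k with
    | zero => exact hZ
    | succ k ih => rw [Function.iterate_succ_apply']; exact .adPot hQ ih
  refine h.star.unique ?_
  convert! h using 2 with k
  have h2 : star ((SpinSystem.adPot Q)^[k] Z S) = _ := hk k S
  simp [h2]

end Potentials
end SpinSystem

/-! ### Counting pairs of overlapping sets. -/

section Combinatorics

variable {ι : Type*} [Fintype ι] [DecidableEq ι]

/-- One of the two sets contains `x`, and the other meets it in one of its sites. The sum over that
site gives the cardinality weight in `A'` and `B'`. -/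
lemma sum_overlapping_le {a b : Finset ι → ℝ} (ha : ∀ S, 0 ≤ a S) (hb : ∀ S, 0 ≤ b S)
    {A A' B B' : ℝ} (x : ι)
    (hA : ∀ y, ∑ S, (if y ∈ S then a S else 0) ≤ A)
    (hB : ∀ y, ∑ S, (if y ∈ S then b S else 0) ≤ B)
    (hA' : ∑ S : Finset ι, (if x ∈ S then S.card * a S else 0) ≤ A')
    (hB' : ∑ S : Finset ι, (if x ∈ S then S.card * b S else 0) ≤ B') :
    ∑ S : Finset ι, ∑ T : Finset ι,
      (if x ∈ S ∪ T ∧ ¬ Disjoint S T then a S * b T else 0) ≤ A * B' + A' * B := by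
  have hsum : ∀ (f : Finset ι → ℝ) (C : ℝ), (∀ S, 0 ≤ f S) →
      (∀ y, ∑ S, (if y ∈ S then f S else 0) ≤ C) → ∀ T : Finset ι,
      ∑ S, (if ¬ Disjoint S T then f S else 0) ≤ T.card * C := fun f C hf hC T => by
    calc ∑ S, (if ¬ Disjoint S T then f S else 0)
        ≤ ∑ S, ∑ y ∈ T, (if y ∈ S then f S else 0) := by
          refine Finset.sum_le_sum fun S _ => ?_
          have h0 : ∀ y ∈ T, 0 ≤ (if y ∈ S then f S else 0) := fun y _ => by
            split_ifs; exacts [hf S, le_rfl]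
          split_ifs with h
          · exact Finset.sum_nonneg h0
          · obtain ⟨y, hy, hy'⟩ := Finset.not_disjoint_iff.1 h
            refine le_trans ?_ (Finset.single_le_sum h0 hy')
            rw [if_pos hy]
      _ = ∑ y ∈ T, ∑ S, (if y ∈ S then f S else 0) := Finset.sum_comm
      _ ≤ ∑ y ∈ T, C := Finset.sum_le_sum fun y _ => hC y
      _ = T.card * C := by simp
  have h1 : ∀ S T : Finset ι, (if x ∈ S ∪ T ∧ ¬ Disjoint S T then a S * b T else 0)
      ≤ (if x ∈ T then b T * (if ¬ Disjoint S T then a S else 0) else 0)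
        + (if x ∈ S then a S * (if ¬ Disjoint T S then b T else 0) else 0) := fun S T => by
    have := mul_nonneg (ha S) (hb T)
    by_cases hd : Disjoint S T
    · simp [hd, hd.symm]
    · have hd' : ¬ Disjoint T S := fun h => hd h.symm
      by_cases hS : x ∈ S <;> by_cases hT : x ∈ T <;> simp [hd, hd', hS, hT] <;> linarith
  have hA0 : 0 ≤ A := le_trans (Finset.sum_nonneg fun S _ => by split_ifs; exacts [ha S, le_rfl])
    (hA x)
  have hB0 : 0 ≤ B := le_trans (Finset.sum_nonneg fun S _ => by split_ifs; exacts [hb S, le_rfl])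
    (hB x)
  have h2 : ∀ (f g : Finset ι → ℝ) (C C' : ℝ), (∀ S, 0 ≤ f S) → (∀ S, 0 ≤ g S) →
      (∀ y, ∑ S, (if y ∈ S then f S else 0) ≤ C) → 0 ≤ C →
      ∑ S : Finset ι, (if x ∈ S then S.card * g S else 0) ≤ C' →
      ∑ T, ∑ S, (if x ∈ T then g T * (if ¬ Disjoint S T then f S else 0) else 0) ≤ C * C' :=
    fun f g C C' hf hg hC hC0 hC' => by
    calc _ ≤ ∑ T : Finset ι, C * (if x ∈ T then T.card * g T else 0) := by
          refine Finset.sum_le_sum fun T _ => ?_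
          split_ifs with hx
          · rw [← Finset.mul_sum]
            calc _ ≤ g T * (T.card * C) := mul_le_mul_of_nonneg_left (hsum f C hf hC T) (hg T)
              _ = _ := by ring
          · simp
      _ = C * ∑ T : Finset ι, (if x ∈ T then T.card * g T else 0) := (Finset.mul_sum ..).symm
      _ ≤ C * C' := mul_le_mul_of_nonneg_left hC' hC0
  calc _ ≤ ∑ S : Finset ι, ∑ T : Finset ι,
        ((if x ∈ T then b T * (if ¬ Disjoint S T then a S else 0) else 0)
        + (if x ∈ S then a S * (if ¬ Disjoint T S then b T else 0) else 0)) :=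
        Finset.sum_le_sum fun S _ => Finset.sum_le_sum fun T _ => h1 S T
    _ = (∑ T : Finset ι, ∑ S : Finset ι,
          (if x ∈ T then b T * (if ¬ Disjoint S T then a S else 0) else 0))
        + ∑ S : Finset ι, ∑ T : Finset ι,
          (if x ∈ S then a S * (if ¬ Disjoint T S then b T else 0) else 0) := by
        simp only [Finset.sum_add_distrib]
        congr 1
        exact Finset.sum_comm
    _ ≤ A * B' + B * A' := add_le_add (h2 a b A B' ha hb hA hA0 hB') (h2 b a B A' hb ha hB hB0 hA')
    _ = _ := by ring

end Combinatorics

namespace SpinSystem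

variable {d : ℕ} {Λ : Finset (Fin d → ℤ)} {q : ℕ}

/-! ### Estimates in the weighted norms, trading decay rate for commutators. -/

section PotNorm

lemma potNorm_nonneg (κ : ℝ) (Z : Family Λ q) : 0 ≤ potNorm κ Z :=
  Real.iSup_nonneg fun _ => Finset.sum_nonneg fun _ _ => by positivity

lemma sum_le_potNorm (κ : ℝ) {Z : Family Λ q} (hZ : IsPotential Z) (x : Λ) :
    ∑ S, (if x ∈ S then Real.exp (κ * S.card) * ‖Z S‖ else 0) ≤ potNorm κ Z := by
  classical
  refine le_trans (le_of_eq ?_) (le_ciSup (Set.finite_range _).bddAbove x)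
  rw [Finset.sum_filter]
  refine Finset.sum_congr rfl fun S _ => ?_
  by_cases hS : IsConnectedSet S
  · simp [hS]
  · simp [hS, hZ.2 S hS]

lemma potNorm_le {κ : ℝ} {Z : Family Λ q} {B : ℝ} (hB : 0 ≤ B)
    (h : ∀ x, ∑ S, (if x ∈ S then Real.exp (κ * S.card) * ‖Z S‖ else 0) ≤ B) :
    potNorm κ Z ≤ B := by
  classical
  refine Real.iSup_le (fun x => le_trans ?_ (h x)) hB
  rw [Finset.sum_filter]
  refine Finset.sum_le_sum fun S _ => ?_
  by_cases hS : x ∈ S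
  · simp only [hS, and_true, if_true]
    split_ifs <;> first | exact le_rfl | positivity
  · simp [hS]

lemma potNorm_le_of_norm_le {κ c : ℝ} {Z W : Family Λ q} (hW : IsPotential W) (hc : 0 ≤ c)
    (h : ∀ S, ‖Z S‖ ≤ c * ‖W S‖) : potNorm κ Z ≤ c * potNorm κ W := by
  refine potNorm_le (mul_nonneg hc (potNorm_nonneg _ _)) fun x => ?_
  refine le_trans ?_ (mul_le_mul_of_nonneg_left (sum_le_potNorm κ hW x) hc)
  rw [Finset.mul_sum]
  refine Finset.sum_le_sum fun S _ => ?_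
  split_ifs
  · calc _ ≤ Real.exp (κ * S.card) * (c * ‖W S‖) := by gcongr; exact h S
      _ = _ := by ring
  · simp

lemma potNorm_mono {κ κ' : ℝ} (h : κ ≤ κ') {Z : Family Λ q} (hZ : IsPotential Z) :
    potNorm κ Z ≤ potNorm κ' Z := by
  refine potNorm_le (potNorm_nonneg _ _) fun x => le_trans ?_ (sum_le_potNorm κ' hZ x)
  refine Finset.sum_le_sum fun S _ => ?_
  split_ifs
  · gcongr
  · exact le_rfl

lemma potNorm_smul_le (κ : ℝ) (c : ℂ) {Z : Family Λ q} (hZ : IsPotential Z) :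
    potNorm κ (c • Z) ≤ ‖c‖ * potNorm κ Z :=
  potNorm_le_of_norm_le hZ (norm_nonneg c) fun S => (norm_smul c (Z S)).le

lemma potNorm_add_le (κ : ℝ) {Z W : Family Λ q} (hZ : IsPotential Z) (hW : IsPotential W) :
    potNorm κ (Z + W) ≤ potNorm κ Z + potNorm κ W := by
  refine potNorm_le (add_nonneg (potNorm_nonneg _ _) (potNorm_nonneg _ _)) fun x => ?_
  refine le_trans ?_ (add_le_add (sum_le_potNorm κ hZ x) (sum_le_potNorm κ hW x))
  rw [← Finset.sum_add_distrib]
  refine Finset.sum_le_sum fun S _ => ?_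
  split_ifs
  · rw [← mul_add]
    gcongr
    exact norm_add_le _ _
  · simp

lemma potNorm_sub_le (κ : ℝ) {Z W : Family Λ q} (hZ : IsPotential Z) (hW : IsPotential W) :
    potNorm κ (Z - W) ≤ potNorm κ Z + potNorm κ W := by
  rw [sub_eq_add_neg, ← neg_one_smul ℂ W]
  refine (potNorm_add_le κ hZ (hW.smul _)).trans ?_
  gcongr
  simpa using potNorm_smul_le κ (-1) hW

lemma potNorm_le_of_hasSum {κ : ℝ} {f : ℕ → Family Λ q} {F : Family Λ q} (h : HasSum f F)
    (hf : ∀ k, IsPotential (f k)) {b : ℕ → ℝ} {B : ℝ} (hb : HasSum b B)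
    (hfb : ∀ k, potNorm κ (f k) ≤ b k) : potNorm κ F ≤ B := by
  have hb0 : ∀ k, 0 ≤ b k := fun k => (potNorm_nonneg _ _).trans (hfb k)
  have hpart : ∀ s : Finset ℕ, IsPotential (∑ k ∈ s, f k) ∧
      potNorm κ (∑ k ∈ s, f k) ≤ ∑ k ∈ s, b k := fun s => by
    classical
    induction s using Finset.induction_on with
    | empty =>
      refine ⟨by simpa using isPotential_zero, ?_⟩
      simpa using potNorm_smul_le κ 0 (isPotential_zero (Λ := Λ) (q := q))
    | insert k s hk ih =>
      rw [Finset.sum_insert hk, Finset.sum_insert hk]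
      exact ⟨(hf k).add ih.1, (potNorm_add_le κ (hf k) ih.1).trans (add_le_add (hfb k) ih.2)⟩
  refine potNorm_le (hb.nonneg hb0) fun x => ?_
  have hc : Continuous fun Z : Family Λ q =>
      ∑ S, (if x ∈ S then Real.exp (κ * S.card) * ‖Z S‖ else 0) := by
    refine continuous_finsetSum _ fun S _ => ?_
    split_ifs <;> fun_prop
  refine le_of_tendsto ((hc.tendsto F).comp h) (.of_forall fun s => ?_)
  exact (sum_le_potNorm κ (hpart s).1 x).trans
    ((hpart s).2.trans (sum_le_hasSum s (fun k _ => hb0 k) hb))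

attribute [local irreducible] potNorm

/-- From `δm ≤ e^{δm-1}`. The factor `1/e` is essential: it later offsets `k^k/k!`. -/
lemma mul_exp_le {δ : ℝ} (hδ : 0 < δ) (κ : ℝ) (m : ℝ) :
    m * Real.exp (κ * m) ≤ (Real.exp 1 * δ)⁻¹ * Real.exp ((κ + δ) * m) := by
  have h1 : δ * m ≤ Real.exp (δ * m - 1) := by linarith [Real.add_one_le_exp (δ * m - 1)]
  have h2 : Real.exp ((κ + δ) * m) = Real.exp (κ * m) * (Real.exp (δ * m - 1) * Real.exp 1) := by
    rw [← Real.exp_add, ← Real.exp_add]; congr 1; ring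
  rw [h2, inv_mul_eq_div, le_div_iff₀ (by positivity)]
  have h3 : 0 < Real.exp (κ * m) * Real.exp 1 := by positivity
  nlinarith [mul_le_mul_of_nonneg_left h1 h3.le]

lemma potNorm_adPot_le {κ δ : ℝ} (hκ : 0 ≤ κ) (hδ : 0 < δ) {Q Z : Family Λ q}
    (hQ : IsPotential Q) (hZ : IsPotential Z) :
    potNorm κ (adPot Q Z) ≤
      4 * Real.exp (-κ) / (Real.exp 1 * δ) * potNorm (κ + δ) Q * potNorm (κ + δ) Z := by
  have hQ0 := potNorm_nonneg (κ + δ) Q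
  have hZ0 := potNorm_nonneg (κ + δ) Z
  have hcard : ∀ {W : Family Λ q}, IsPotential W → ∀ x : Λ, ∑ S : Finset Λ,
      (if x ∈ S then (S.card : ℝ) * (Real.exp (κ * S.card) * ‖W S‖) else 0)
        ≤ (Real.exp 1 * δ)⁻¹ * potNorm (κ + δ) W := fun {W} hW x => by
    refine le_trans ?_ (mul_le_mul_of_nonneg_left (sum_le_potNorm (κ + δ) hW x) (by positivity))
    rw [Finset.mul_sum]
    refine Finset.sum_le_sum fun S _ => ?_
    split_ifs
    · rw [← mul_assoc, ← mul_assoc]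
      exact mul_le_mul_of_nonneg_right (mul_exp_le hδ κ _) (norm_nonneg _)
    · simp
  refine potNorm_le (by positivity) fun x => ?_
  have hmain := sum_overlapping_le (a := fun S => Real.exp (κ * S.card) * ‖Q S‖)
    (b := fun S => Real.exp (κ * S.card) * ‖Z S‖) (fun S => by positivity)
    (fun S => by positivity) x
    (fun y => (sum_le_potNorm κ hQ y).trans (potNorm_mono (by linarith : κ ≤ κ + δ) hQ))
    (fun y => (sum_le_potNorm κ hZ y).trans (potNorm_mono (by linarith : κ ≤ κ + δ) hZ))
    (hcard hQ x) (hcard hZ x)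
  have hterm : ∀ S T : Finset Λ,
      (if x ∈ S ∪ T then Real.exp (κ * (S ∪ T).card) * ‖Q S * Z T - Z T * Q S‖ else 0)
      ≤ 2 * Real.exp (-κ) * (if x ∈ S ∪ T ∧ ¬ Disjoint S T then
        (Real.exp (κ * S.card) * ‖Q S‖) * (Real.exp (κ * T.card) * ‖Z T‖) else 0) := fun S T => by
    by_cases hd : Disjoint S T
    · rw [commutator_eq_zero hQ hZ (by tauto)]
      simp [hd]
    · simp only [hd, not_false_iff, and_true]
      split_ifs with hx
      · have h1 : ‖Q S * Z T - Z T * Q S‖ ≤ 2 * (‖Q S‖ * ‖Z T‖) := by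
          refine (norm_sub_le _ _).trans ?_
          have := norm_mul_le (Q S) (Z T)
          have := norm_mul_le (Z T) (Q S)
          linarith [mul_comm ‖Q S‖ ‖Z T‖]
        -- Overlapping sets share a site, so the union has at most `|S| + |T| - 1` sites. The gain
        -- `e^{-κ}` will be used as `1/κ`.
        have h2 : Real.exp (κ * (S ∪ T).card) ≤
            Real.exp (-κ) * Real.exp (κ * S.card) * Real.exp (κ * T.card) := by
          rw [← Real.exp_add, ← Real.exp_add]
          refine Real.exp_le_exp.2 ?_
          have h3 : 1 ≤ (S ∩ T).card :=
            Finset.card_pos.2 (Finset.not_disjoint_iff_nonempty_inter.1 hd)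
          have h4 := Finset.card_union_add_card_inter S T
          have h5 : ((S ∪ T).card : ℝ) ≤ S.card + T.card - 1 := by
            have : (S ∪ T).card + 1 ≤ S.card + T.card := by omega
            have : ((S ∪ T).card : ℝ) + 1 ≤ S.card + T.card := by exact_mod_cast this
            linarith
          nlinarith
        calc _ ≤ (Real.exp (-κ) * Real.exp (κ * S.card) * Real.exp (κ * T.card))
              * (2 * (‖Q S‖ * ‖Z T‖)) := by gcongr
          _ = _ := by ring
      · simp
  calc ∑ S, (if x ∈ S then Real.exp (κ * S.card) * ‖adPot Q Z S‖ else 0)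
      ≤ ∑ S, ∑ S₁, ∑ S₂, (if S₁ ∪ S₂ = S then (if x ∈ S₁ ∪ S₂ then
          Real.exp (κ * (S₁ ∪ S₂).card) * ‖Q S₁ * Z S₂ - Z S₂ * Q S₁‖ else 0) else 0) := by
        refine Finset.sum_le_sum fun S _ => ?_
        by_cases hx : x ∈ S
        · rw [if_pos hx, adPot]
          calc _ ≤ Real.exp (κ * S.card) * ∑ S₁, ∑ S₂,
                ‖if S₁ ∪ S₂ = S then Q S₁ * Z S₂ - Z S₂ * Q S₁ else 0‖ := by
                gcongr
                exact (norm_sum_le _ _).trans (Finset.sum_le_sum fun _ _ => norm_sum_le _ _)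
            _ ≤ _ := by
                simp only [Finset.mul_sum]
                refine Finset.sum_le_sum fun S₁ _ => Finset.sum_le_sum fun S₂ _ => ?_
                by_cases h : S₁ ∪ S₂ = S
                · simp [h, hx]
                · simp [h]
        · rw [if_neg hx]
          refine Finset.sum_nonneg fun S₁ _ => Finset.sum_nonneg fun S₂ _ => ?_
          split_ifs <;> positivity
    _ = ∑ S₁, ∑ S₂, (if x ∈ S₁ ∪ S₂ then
          Real.exp (κ * (S₁ ∪ S₂).card) * ‖Q S₁ * Z S₂ - Z S₂ * Q S₁‖ else 0) := by
        rw [Finset.sum_comm]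
        refine Finset.sum_congr rfl fun S₁ _ => ?_
        rw [Finset.sum_comm]
        refine Finset.sum_congr rfl fun S₂ _ => ?_
        rw [Finset.sum_ite_eq, if_pos (Finset.mem_univ _)]
    _ ≤ _ := Finset.sum_le_sum fun S₁ _ => Finset.sum_le_sum fun S₂ _ => hterm S₁ S₂
    _ ≤ 2 * Real.exp (-κ) * (potNorm (κ + δ) Q * ((Real.exp 1 * δ)⁻¹ * potNorm (κ + δ) Z)
          + (Real.exp 1 * δ)⁻¹ * potNorm (κ + δ) Q * potNorm (κ + δ) Z) := by
        simp only [← Finset.mul_sum]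
        exact mul_le_mul_of_nonneg_left hmain (by positivity)
    _ = _ := by rw [div_eq_mul_inv]; ring

/-- Each commutator gives up `s` of the rate: the outermost is estimated at `κ`, and the inner ones
start from `κ + s`. -/
lemma potNorm_adPot_iterate_le {s : ℝ} (hs : 0 < s) {Q : Family Λ q} (hQ : IsPotential Q) {w : ℝ}
    (j : ℕ) : ∀ {κ : ℝ} {Z : Family Λ q}, 0 ≤ κ → IsPotential Z → potNorm (κ + j * s) Q ≤ w →
    potNorm κ ((adPot Q)^[j] Z) ≤
      (4 * Real.exp (-κ) / (Real.exp 1 * s) * w) ^ j * potNorm (κ + j * s) Z := by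
  induction j with
  | zero => intro κ Z _ _ _; simp
  | succ j ih =>
    intro κ Z hκ hZ hw
    have hw0 : 0 ≤ w := (potNorm_nonneg _ _).trans hw
    have hadd : κ + s + j * s = κ + (j + 1 : ℕ) * s := by push_cast; ring
    have h1 := ih (κ := κ + s) (by linarith) hZ (hadd ▸ hw)
    rw [hadd] at h1
    rw [Function.iterate_succ_apply']
    have h2 : potNorm (κ + s) Q ≤ w := by
      refine (potNorm_mono ?_ hQ).trans hw
      rw [← hadd]
      nlinarith [(Nat.cast_nonneg j : (0 : ℝ) ≤ j)]
    have h3 : Real.exp (-(κ + s)) ≤ Real.exp (-κ) := Real.exp_le_exp.2 (by linarith)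
    have hn := potNorm_nonneg (κ + (j + 1 : ℕ) * s) Z
    refine (potNorm_adPot_le hκ hs hQ (hQ.adPot_iterate hZ j)).trans ?_
    calc _ ≤ 4 * Real.exp (-κ) / (Real.exp 1 * s) * w *
          ((4 * Real.exp (-κ) / (Real.exp 1 * s) * w) ^ j * potNorm (κ + (j + 1 : ℕ) * s) Z) := by
          refine mul_le_mul (by gcongr) (h1.trans (by gcongr)) (potNorm_nonneg _ _) (by positivity)
      _ = _ := by ring

/-- The loss `δ` is split into `k` equal parts `δ/k`. The resulting factor `(k/e)^k` is at most
`k!`. -/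
lemma potNorm_factorial_adPot_iterate_le {κ δ : ℝ} (hκ : 0 < κ) (hδ : 0 < δ) {Q Z : Family Λ q}
    (hQ : IsPotential Q) (hZ : IsPotential Z) (k : ℕ) :
    (k.factorial : ℝ)⁻¹ * potNorm κ ((adPot Q)^[k] Z) ≤
      (4 * (potNorm (κ + δ) Q / (κ * δ))) ^ k * potNorm (κ + δ) Z := by
  have hw := potNorm_nonneg (κ + δ) Q
  have hz := potNorm_nonneg (κ + δ) Z
  rcases Nat.eq_zero_or_pos k with rfl | hk
  · simpa using potNorm_mono (by linarith) hZ
  have hk' : (0 : ℝ) < k := Nat.cast_pos.2 hk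
  have hks : κ + k * (δ / k) = κ + δ := by field_simp
  have h1 := potNorm_adPot_iterate_le (s := δ / k) (by positivity) hQ (w := potNorm (κ + δ) Q) k
    hκ.le hZ (by rw [hks])
  rw [hks] at h1
  have h2 : Real.exp (-κ) ≤ κ⁻¹ := by
    rw [Real.exp_neg]
    exact inv_anti₀ hκ (by linarith [Real.add_one_le_exp κ])
  have h3 := Real.pow_div_factorial_le_exp (x := (k : ℝ)) hk'.le k
  calc _ ≤ (k.factorial : ℝ)⁻¹ * ((4 * κ⁻¹ / (Real.exp 1 * (δ / k)) * potNorm (κ + δ) Q) ^ k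
        * potNorm (κ + δ) Z) := by
        refine mul_le_mul_of_nonneg_left (h1.trans ?_) (by positivity)
        gcongr
    _ = ((4 * (potNorm (κ + δ) Q / (κ * δ))) ^ k * potNorm (κ + δ) Z)
        * ((k : ℝ) ^ k / k.factorial / Real.exp k) := by
        have h4 : 4 * κ⁻¹ / (Real.exp 1 * (δ / k)) * potNorm (κ + δ) Q
            = 4 * (potNorm (κ + δ) Q / (κ * δ)) * (k / Real.exp 1) := by field_simp
        rw [h4, mul_pow, div_pow, ← Real.exp_nat_mul, mul_one]
        field_simp
    _ ≤ ((4 * (potNorm (κ + δ) Q / (κ * δ))) ^ k * potNorm (κ + δ) Z) * 1 := by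
        refine mul_le_mul_of_nonneg_left ?_ (by positivity)
        rwa [div_le_one (by positivity)]
    _ = _ := mul_one _

/-- General coefficients cover both `e^{ad_Q} - 1` and the series for the off-diagonal part in one
renormalization step. The vanishing of `c 0` makes the result of first order in `Q`. -/
lemma potNorm_adPot_series_le {κ δ : ℝ} (hκ : 0 < κ) (hδ : 0 < δ) {Q Z F : Family Λ q}
    (hQ : IsPotential Q) (hZ : IsPotential Z)
    (hη : potNorm (κ + δ) Q / (κ * δ) ≤ 1 / 20) {c : ℕ → ℂ} (hc0 : c 0 = 0)
    (hc : ∀ k, ‖c k‖ ≤ (k.factorial : ℝ)⁻¹) (hF : HasSum (fun k => c k • (adPot Q)^[k] Z) F) :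
    potNorm κ F ≤ 5 * (potNorm (κ + δ) Q / (κ * δ)) * potNorm (κ + δ) Z := by
  set η := potNorm (κ + δ) Q / (κ * δ) with hηd
  have hz := potNorm_nonneg (κ + δ) Z
  have hη0 : 0 ≤ η := div_nonneg (potNorm_nonneg _ _) (by positivity)
  have hg := (hasSum_geometric_of_lt_one (r := 4 * η) (by positivity) (by linarith))
  have hg' : HasSum (fun k : ℕ => if k = 0 then 0 else (4 * η) ^ k * potNorm (κ + δ) Z)
      (((1 - 4 * η)⁻¹ - 1) * potNorm (κ + δ) Z) := by
    have h1 := (hg.sub (hasSum_ite_eq 0 (1 : ℝ))).mul_right (potNorm (κ + δ) Z)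
    convert! h1 using 2 with k
    split_ifs with hk <;> simp [hk]
  have hb := potNorm_le_of_hasSum (κ := κ) hF (fun k => (hQ.adPot_iterate hZ k).smul _) hg'
    fun k => by
      split_ifs with h
      · subst h
        simpa [hc0] using potNorm_smul_le κ 0 hZ
      · refine (potNorm_smul_le κ _ (hQ.adPot_iterate hZ k)).trans ?_
        refine le_trans ?_ (potNorm_factorial_adPot_iterate_le hκ hδ hQ hZ k)
        exact mul_le_mul_of_nonneg_right (hc k) (potNorm_nonneg _ _)
  -- The geometric tail is `4η/(1 - 4η)`, at most `5η` because `4η ≤ 1/5`.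
  refine hb.trans (mul_le_mul_of_nonneg_right ?_ hz)
  rw [sub_le_iff_le_add, inv_le_comm₀ (by linarith) (by linarith), ← one_div,
    div_le_iff₀ (by linarith)]
  nlinarith

lemma potNorm_expAd_sub_le {κ δ : ℝ} (hκ : 0 < κ) (hδ : 0 < δ) {Q Z : Family Λ q}
    (hQ : IsPotential Q) (hZ : IsPotential Z)
    (hη : potNorm (κ + δ) Q / (κ * δ) ≤ 1 / 20) :
    potNorm κ (expAd Q Z - Z) ≤ 5 * (potNorm (κ + δ) Q / (κ * δ)) * potNorm (κ + δ) Z := by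
  refine potNorm_adPot_series_le hκ hδ hQ hZ hη
    (c := fun k => if k = 0 then 0 else (k.factorial : ℂ)⁻¹) (by simp) (fun k => ?_) ?_
  · split_ifs <;> simp
  · have h := (hasSum_expAd Q Z).sub (hasSum_ite_eq 0 Z)
    convert! h using 2 with k
    split_ifs with hk
    · simp [hk]
    · simp

end PotNorm

end SpinSystem

namespace SpinSystem

variable {d : ℕ} {Λ : Finset (Fin d → ℤ)} {q : ℕ}

/-! ### One renormalization step. -/

section Step

open Complex

variable {N : Λ → Op Λ q}

lemma IsNumberFamily.isSelfAdjoint_total (hN : IsNumberFamily N) : IsSelfAdjoint (∑ x, N x) :=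
  hN.isHermitian_sum _

lemma IsNumberFamily.diagPart_add (hN : IsNumberFamily N) (O P : Op Λ q) :
    diagPart N (O + P) = diagPart N O + diagPart N P := by
  simp only [hN.diagPart_eq, rotAverage_add]

lemma IsNumberFamily.diagPart_sub (hN : IsNumberFamily N) (O P : Op Λ q) :
    diagPart N (O - P) = diagPart N O - diagPart N P := by
  simp only [hN.diagPart_eq, rotAverage_sub]

lemma IsNumberFamily.commute_diagPart (hN : IsNumberFamily N) (O : Op Λ q) :
    Commute (∑ x, N x) (diagPart N O) := by
  rw [hN.diagPart_eq]
  exact commute_rotAverage (hN.propagator_sum _) O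

lemma IsNumberFamily.diagPart_diagPart (hN : IsNumberFamily N) (O : Op Λ q) :
    diagPart N (diagPart N O) = diagPart N O := by
  rw [hN.diagPart_eq (diagPart N O)]
  exact rotAverage_of_commute (hN.commute_diagPart O)

lemma IsNumberFamily.diagPart_zero (hN : IsNumberFamily N) : diagPart N 0 = 0 := by
  simpa using hN.diagPart_sub 0 0

lemma IsNumberFamily.diagPart_sum (hN : IsNumberFamily N) {ι : Type*} (s : Finset ι)
    (f : ι → Op Λ q) : diagPart N (∑ i ∈ s, f i) = ∑ i ∈ s, diagPart N (f i) :=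
  map_sum (⟨⟨diagPart N, hN.diagPart_zero⟩, hN.diagPart_add⟩ : Op Λ q →+ Op Λ q) f s

lemma IsNumberFamily.isPotential_diagPot (hN : IsNumberFamily N) {Z : Family Λ q}
    (hZ : IsPotential Z) : IsPotential (diagPot N Z) :=
  ⟨fun S => hN.actsWithin_diagPart (hZ.1 S), fun S hS => by
    rw [diagPot, hZ.2 S hS, hN.diagPart_zero]⟩

lemma IsNumberFamily.isPotential_offPot (hN : IsNumberFamily N) {Z : Family Λ q}
    (hZ : IsPotential Z) : IsPotential (offPot N Z) :=
  hZ.sub (hN.isPotential_diagPot hZ)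

lemma IsNumberFamily.isHermitian_diagPot (hN : IsNumberFamily N) {Z : Family Λ q}
    (hZ : IsHermitianFamily Z) : IsHermitianFamily (diagPot N Z) := fun S => by
  have h := star_rotAverage hN.isSelfAdjoint_total (Z S)
  rw [show star (Z S) = Z S from hZ S, ← hN.diagPart_eq] at h
  exact h

lemma IsNumberFamily.isHermitian_offPot (hN : IsNumberFamily N) {Z : Family Λ q}
    (hZ : IsHermitianFamily Z) : IsHermitianFamily (offPot N Z) := fun S =>
  (hZ S).sub (hN.isHermitian_diagPot hZ S)

lemma IsNumberFamily.potNorm_diagPot_le (hN : IsNumberFamily N) (κ : ℝ) {Z : Family Λ q}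
    (hZ : IsPotential Z) : potNorm κ (diagPot N Z) ≤ potNorm κ Z := by
  simpa using potNorm_le_of_norm_le (κ := κ) (Z := diagPot N Z) hZ zero_le_one fun S => by
    rw [one_mul, diagPot, hN.diagPart_eq]
    exact norm_rotAverage_le hN.isSelfAdjoint_total _

lemma IsNumberFamily.diagPot_sub (hN : IsNumberFamily N) (Z W : Family Λ q) :
    diagPot N (Z - W) = diagPot N Z - diagPot N W := by
  funext S; exact hN.diagPart_sub _ _

lemma IsNumberFamily.diagPot_diagPot (hN : IsNumberFamily N) (Z : Family Λ q) :
    diagPot N (diagPot N Z) = diagPot N Z := by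
  funext S; exact hN.diagPart_diagPart _

lemma IsNumberFamily.diagPot_offPot (hN : IsNumberFamily N) (Z : Family Λ q) :
    diagPot N (offPot N Z) = 0 := by
  rw [offPot, hN.diagPot_sub, hN.diagPot_diagPot, sub_self]

lemma diagPot_add_offPot (N : Λ → Op Λ q) (Z : Family Λ q) : diagPot N Z + offPot N Z = Z := by
  rw [offPot, add_sub_cancel]

lemma IsNumberFamily.toOp_diagPot (hN : IsNumberFamily N) (Z : Family Λ q) :
    toOp (diagPot N Z) = diagPart N (toOp Z) := (hN.diagPart_sum _ _).symm

lemma toOp_numPot (N : Λ → Op Λ q) : toOp (numPot N) = ∑ x, N x := by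
  simp only [toOp, numPot]
  rw [Finset.sum_comm]
  simp

lemma toOp_add (Z W : Family Λ q) : toOp (Z + W) = toOp Z + toOp W := by
  simp [toOp, Finset.sum_add_distrib]

lemma toOp_smul (c : ℂ) (Z : Family Λ q) : toOp (c • Z) = c • toOp Z := by
  simp [toOp, Finset.smul_sum]

/-- A site outside `S₁` gives a zero commutator, and a site inside does not change the union. Hence
`[A, νN] = -V` can be solved set by set. -/
lemma IsNumberFamily.adPot_numPot (hN : IsNumberFamily N) {Q : Family Λ q} (hQ : IsPotential Q)
    (S : Finset Λ) :
    adPot Q (numPot N) S = Q S * (∑ x, N x) - (∑ x, N x) * Q S := by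
  have h0 : ∀ (S₁ : Finset Λ) (x : Λ), x ∉ S₁ → Q S₁ * N x - N x * Q S₁ = 0 := fun S₁ x hx => by
    rw [((hQ.1 S₁).commute (by simpa using hx) (hN x).1).eq, sub_self]
  have h1 : ∀ S₁ S₂ : Finset Λ,
      (if S₁ ∪ S₂ = S then Q S₁ * numPot N S₂ - numPot N S₂ * Q S₁ else 0)
      = ∑ x, if S₂ = {x} then (if S₁ ∪ {x} = S then Q S₁ * N x - N x * Q S₁ else 0) else 0 :=
    fun S₁ S₂ => by
    simp only [numPot, Finset.mul_sum, Finset.sum_mul, ← Finset.sum_sub_distrib]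
    by_cases h : S₁ ∪ S₂ = S
    · rw [if_pos h]
      refine Finset.sum_congr rfl fun x _ => ?_
      by_cases hx : S₂ = {x}
      · subst hx; simp [h]
      · simp [hx]
    · rw [if_neg h]
      refine (Finset.sum_eq_zero fun x _ => ?_).symm
      by_cases hx : S₂ = {x}
      · subst hx; rw [if_pos rfl, if_neg h]
      · simp [hx]
  have h2 : ∀ (S₁ : Finset Λ) (x : Λ),
      (if S₁ ∪ {x} = S then Q S₁ * N x - N x * Q S₁ else 0)
      = if S₁ = S then Q S₁ * N x - N x * Q S₁ else 0 := fun S₁ x => by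
    by_cases hx : x ∈ S₁
    · rw [Finset.union_eq_left.2 (Finset.singleton_subset_iff.2 hx)]
    · simp [h0 S₁ x hx]
  have h3 : ∀ S₁ : Finset Λ, ∑ S₂ : Finset Λ, ∑ x, (if S₂ = {x} then
      (if S₁ = S then Q S₁ * N x - N x * Q S₁ else 0) else 0)
      = ∑ x, if S₁ = S then Q S₁ * N x - N x * Q S₁ else 0 := fun S₁ => by
    rw [Finset.sum_comm]
    exact Finset.sum_congr rfl fun x _ => by rw [Finset.sum_ite_eq', if_pos (Finset.mem_univ _)]
  simp only [adPot, h1, h2, h3]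
  rw [Finset.sum_comm]
  simp only [Finset.sum_ite_eq', Finset.mem_univ, if_true, Finset.sum_sub_distrib,
    Finset.mul_sum, Finset.sum_mul]

/-- The potential `A` that solves `[A, ν N] = -V` for an off-diagonal potential `V`. -/
noncomputable def generator (N : Λ → Op Λ q) (ν : ℝ) (V : Family Λ q) : Family Λ q :=
  fun S => (I / ν) • rotSawtooth (∑ x, N x) (V S)

lemma rotSawtooth_zero {𝔄 : Type*} [CStarAlgebra 𝔄] (M : 𝔄) : rotSawtooth M 0 = 0 := by
  simp [rotSawtooth, rotate]

lemma IsNumberFamily.isPotential_generator (hN : IsNumberFamily N) (ν : ℝ) {V : Family Λ q}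
    (hV : IsPotential V) : IsPotential (generator N ν V) :=
  ⟨fun S => (hN.actsWithin_rotSawtooth (hV.1 S)).smul _, fun S hS => by
    rw [generator, hV.2 S hS, rotSawtooth_zero, smul_zero]⟩

lemma IsNumberFamily.isAntiHermitian_generator (hN : IsNumberFamily N) (ν : ℝ) {V : Family Λ q}
    (hV : IsHermitianFamily V) : IsAntiHermitianFamily (generator N ν V) := fun S => by
  have h := star_rotSawtooth hN.isSelfAdjoint_total (V S)
  rw [show star (V S) = V S from hV S] at h
  change star _ = _
  rw [generator, star_smul, h]
  simp [neg_div]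

lemma IsNumberFamily.potNorm_generator_le (hN : IsNumberFamily N) {ν : ℝ} (hν : 0 < ν) (κ : ℝ)
    {V : Family Λ q} (hV : IsPotential V) :
    potNorm κ (generator N ν V) ≤ Real.pi / ν * potNorm κ V := by
  have := Real.pi_pos
  refine potNorm_le_of_norm_le hV (by positivity) fun S => ?_
  have h := norm_rotSawtooth_le hN.isSelfAdjoint_total (V S)
  rw [generator, norm_smul, norm_div, norm_I, norm_real, Real.norm_eq_abs, abs_of_pos hν]
  calc _ ≤ 1 / ν * (Real.pi * ‖V S‖) := by gcongr
    _ = _ := by ring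

lemma IsNumberFamily.adPot_generator (hN : IsNumberFamily N) {ν : ℝ} (hν : 0 < ν)
    {V : Family Λ q} (hV : IsPotential V) (h0 : diagPot N V = 0) :
    adPot (generator N ν V) ((ν : ℂ) • numPot N) = -V := by
  have hν' : (ν : ℂ) ≠ 0 := by exact_mod_cast hν.ne'
  rw [adPot_smul]
  funext S
  have h1 := commutator_rotSawtooth (hN.propagator_sum Finset.univ) (V S)
  rw [← hN.diagPart_eq, show diagPart N (V S) = 0 from congrFun h0 S, sub_zero] at h1
  rw [Pi.smul_apply, hN.adPot_numPot (hN.isPotential_generator ν hV), Pi.neg_apply, ← h1,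
    generator, smul_mul_assoc, mul_smul_comm, ← smul_sub, smul_smul, mul_div_cancel₀ _ hν',
    ← smul_neg, neg_sub]

/-- One step of the renormalization: the potential `H'` with
`e^{ad_A} (ν N + H) = ν N + H'`, where `A` is the generator for the off-diagonal part of `H`. -/
noncomputable def renormalize (N : Λ → Op Λ q) (ν : ℝ) (H : Family Λ q) : Family Λ q :=
  expAd (generator N ν (offPot N H)) ((ν : ℂ) • numPot N + H) - (ν : ℂ) • numPot N

lemma IsNumberFamily.isPotential_renormalize (hN : IsNumberFamily N) (ν : ℝ) {H : Family Λ q}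
    (hH : IsPotential H) : IsPotential (renormalize N ν H) :=
  ((hN.isPotential_generator ν (hN.isPotential_offPot hH)).expAd
    (((isPotential_numPot hN).smul _).add hH)).sub ((isPotential_numPot hN).smul _)

lemma IsNumberFamily.isHermitian_renormalize (hN : IsNumberFamily N) (ν : ℝ) {H : Family Λ q}
    (hH : IsHermitianFamily H) : IsHermitianFamily (renormalize N ν H) := by
  have hNum : IsHermitianFamily ((ν : ℂ) • numPot N) := fun S => by
    refine IsSelfAdjoint.smul (r := (ν : ℂ)) (Complex.conj_ofReal ν)
      (isSelfAdjoint_sum _ fun x _ => ?_)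
    split_ifs
    · exact (hN x).2.1
    · exact IsSelfAdjoint.zero _
  exact fun S => (isHermitianFamily_expAd
    (hN.isAntiHermitian_generator ν (hN.isHermitian_offPot hH))
    (fun S => (hNum S).add (hH S)) S).sub (hNum S)

/-- As `[A, νN] = -V`, the series of `e^{ad_A}(νN) - νN` is that of `V` with `1/k!` replaced by
`-1/(k+1)!`. The sum with `e^{ad_A} V` has zero coefficient at `k = 0`. -/
lemma IsNumberFamily.hasSum_renormalize (hN : IsNumberFamily N) {ν : ℝ} (hν : 0 < ν)
    {H : Family Λ q} (hH : IsPotential H) :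
    HasSum (fun k : ℕ => ((k.factorial : ℂ)⁻¹ - ((k + 1).factorial : ℂ)⁻¹) •
        (adPot (generator N ν (offPot N H)))^[k] (offPot N H))
      (renormalize N ν H - expAd (generator N ν (offPot N H)) (diagPot N H)) := by
  set A := generator N ν (offPot N H) with hA
  have h1 := hasSum_expAd A (offPot N H)
  -- Dropping the zeroth term `νN` shifts the index, leaving one commutator with `νN` in every term.
  have h2 := (hasSum_nat_add_iff' 1).2 (hasSum_expAd A ((ν : ℂ) • numPot N))
  have hAN := hN.adPot_generator hν (hN.isPotential_offPot hH) (hN.diagPot_offPot H)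
  rw [← hA] at hAN
  have hneg : ∀ (k : ℕ) (W : Family Λ q), (adPot A)^[k] (-W) = -(adPot A)^[k] W := fun k W => by
    induction k with
    | zero => rfl
    | succ k ih => rw [Function.iterate_succ_apply', Function.iterate_succ_apply', ih, adPot_neg]
  have h3 := h1.add h2
  convert! h3 using 1
  · funext k
    rw [Function.iterate_succ_apply, hAN, hneg, smul_neg, ← sub_eq_add_neg, sub_smul]
  · rw [renormalize, ← hA]
    conv_lhs => rw [← diagPot_add_offPot N H]
    rw [diagPot_add_offPot, Finset.sum_range_one]
    conv_lhs => enter [1, 1]; rw [← diagPot_add_offPot N H, expAd_add, expAd_add]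
    simp
    abel

lemma IsNumberFamily.potNorm_renormalize_sub_le (hN : IsNumberFamily N) {ν : ℝ} (hν : 0 < ν)
    {κ δ : ℝ} (hκ : 0 < κ) (hδ : 0 < δ) {H : Family Λ q} (hH : IsPotential H)
    (hη : potNorm (κ + δ) (generator N ν (offPot N H)) / (κ * δ) ≤ 1 / 20) :
    potNorm κ (renormalize N ν H - diagPot N H) ≤
      5 * (potNorm (κ + δ) (generator N ν (offPot N H)) / (κ * δ)) *
        (potNorm (κ + δ) (diagPot N H) + potNorm (κ + δ) (offPot N H)) := by
  have hD := hN.isPotential_diagPot hH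
  have hV := hN.isPotential_offPot hH
  have hA := hN.isPotential_generator ν hV
  have h1 := potNorm_expAd_sub_le hκ hδ hA hD hη
  have h2 := potNorm_adPot_series_le hκ hδ hA hV hη
    (c := fun k => (k.factorial : ℂ)⁻¹ - ((k + 1).factorial : ℂ)⁻¹) (by simp) (fun k => ?_)
    (hN.hasSum_renormalize hν hH)
  · have h3 := potNorm_add_le κ ((hN.isPotential_renormalize ν hH).sub (hA.expAd hD))
      ((hA.expAd hD).sub hD)
    rw [sub_add_sub_cancel] at h3
    linarith [mul_add (5 * (potNorm (κ + δ) (generator N ν (offPot N H)) / (κ * δ)))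
      (potNorm (κ + δ) (diagPot N H)) (potNorm (κ + δ) (offPot N H))]
  · have h3 : ((k.factorial : ℂ)⁻¹ - ((k + 1).factorial : ℂ)⁻¹)
        = (((k.factorial : ℝ)⁻¹ - ((k + 1).factorial : ℝ)⁻¹ : ℝ) : ℂ) := by push_cast; rfl
    have h4 : ((k + 1).factorial : ℝ)⁻¹ ≤ (k.factorial : ℝ)⁻¹ :=
      inv_anti₀ (by positivity) (by exact_mod_cast Nat.factorial_le (Nat.le_succ k))
    have h5 : (0 : ℝ) ≤ ((k + 1).factorial : ℝ)⁻¹ := by positivity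
    rw [h3, norm_real, Real.norm_eq_abs, abs_of_nonneg (by linarith)]
    linarith

lemma IsNumberFamily.diagPot_renormalize_sub (hN : IsNumberFamily N) (ν : ℝ) (H : Family Λ q) :
    diagPot N (renormalize N ν H) - diagPot N H
      = diagPot N (renormalize N ν H - diagPot N H) := by
  rw [hN.diagPot_sub, hN.diagPot_diagPot]

/-- The old diagonal part has no off-diagonal part, so only the change `W` matters, and `W - ⟨W⟩`
costs a factor `2`. -/
lemma IsNumberFamily.potNorm_offPot_renormalize_le (hN : IsNumberFamily N) (ν κ : ℝ)
    {H : Family Λ q} (hH : IsPotential H) :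
    potNorm κ (offPot N (renormalize N ν H)) ≤
      2 * potNorm κ (renormalize N ν H - diagPot N H) := by
  have hW := (hN.isPotential_renormalize ν hH).sub (hN.isPotential_diagPot hH)
  have h : offPot N (renormalize N ν H) = (renormalize N ν H - diagPot N H)
      - diagPot N (renormalize N ν H - diagPot N H) := by
    rw [← hN.diagPot_renormalize_sub, offPot]; abel
  rw [h]
  have h1 := potNorm_sub_le κ hW (hN.isPotential_diagPot hW)
  have h2 := hN.potNorm_diagPot_le κ hW
  linarith

end Step

/-! ### The product of the exponentials as a unitary and as a map of potentials. -/

section Dressing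

variable {A : ℕ → Family Λ q}

lemma star_toOp {Q : Family Λ q} (hQ : IsAntiHermitianFamily Q) : star (toOp Q) = -toOp Q := by
  rw [toOp, star_sum, ← Finset.sum_neg_distrib]
  exact Finset.sum_congr rfl fun S _ => hQ S

lemma dressing_mem_unitaryGroup (hA : ∀ j, IsAntiHermitianFamily (A j)) (k : ℕ) :
    dressing A k ∈ Matrix.unitaryGroup (Λ → Fin q) ℂ := by
  let _ : NormedAlgebra ℚ (Op Λ q) := NormedAlgebra.restrictScalars ℚ ℂ _
  induction k with
  | zero => exact one_mem _
  | succ k ih =>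
    exact mul_mem (NormedSpace.exp_mem_unitary_of_mem_skewAdjoint (star_toOp (hA k))) ih

lemma toOp_dressPot (hA : ∀ j, IsAntiHermitianFamily (A j)) (Z : Family Λ q) (k : ℕ) :
    toOp (dressPot A Z k) = dressing A k * toOp Z * (dressing A k).conjTranspose := by
  induction k with
  | zero => simp [dressPot, dressing]
  | succ k ih =>
    have h : (NormedSpace.exp (toOp (A k))).conjTranspose = NormedSpace.exp (-toOp (A k)) := by
      rw [← star_toOp (hA k)]
      exact NormedSpace.star_exp _
    rw [dressPot, dressing, toOp_expAd, ih, Matrix.conjTranspose_mul, h]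
    simp only [mul_assoc]

lemma isPotential_dressPot (hA : ∀ j, IsPotential (A j)) {Z : Family Λ q} (hZ : IsPotential Z)
    (k : ℕ) : IsPotential (dressPot A Z k) := by
  induction k with
  | zero => exact hZ
  | succ k ih => exact (hA k).expAd ih

end Dressing

end SpinSystem

namespace SpinSystem

/-! ### The decay rates, the range of admissible steps and the summable step sizes. -/

section Rates

/-- The growth `(n + 2) (1 + log (n + 2))³` of the inverse spacing of the decay rates. -/
noncomputable def rateGrowth (n : ℕ) : ℝ := ((n : ℝ) + 2) * (1 + Real.log (n + 2)) ^ 3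

lemma log_natCast_add_nonneg (n : ℕ) {a : ℝ} (ha : 1 ≤ a) : 0 ≤ Real.log (n + a) :=
  Real.log_nonneg (by linarith [(Nat.cast_nonneg n : (0 : ℝ) ≤ n)])

lemma rateGrowth_pos (n : ℕ) : 0 < rateGrowth n := by
  have := log_natCast_add_nonneg n (one_le_two)
  unfold rateGrowth; positivity

lemma decayRate_pos {κ₀ : ℝ} (h : 0 < κ₀) (n : ℕ) : 0 < decayRate κ₀ n := by
  have := log_natCast_add_nonneg n le_rfl
  unfold decayRate; positivity

lemma decayRate_zero (κ₀ : ℝ) : decayRate κ₀ 0 = κ₀ := by simp [decayRate]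

/-- With `a = log (n+1)` and `b = log (n+2)` the product is `κ₀²(b - a)/((1 + a)(1 + b)²)`; here `b
- a ≥ 1/(n+2)` and `a ≤ b`. -/
lemma le_decayRate_mul_sub {κ₀ : ℝ} (h : 0 < κ₀) (n : ℕ) :
    κ₀ ^ 2 / rateGrowth n ≤
      decayRate κ₀ (n + 1) * (decayRate κ₀ n - decayRate κ₀ (n + 1)) := by
  have h1 := log_natCast_add_nonneg n (le_refl (1 : ℝ))
  have h2 := log_natCast_add_nonneg n (one_le_two)
  have hn : (0 : ℝ) ≤ n := Nat.cast_nonneg n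
  have hcast : ((n + 1 : ℕ) : ℝ) + 1 = n + 2 := by push_cast; ring
  have hlog : ((n : ℝ) + 2)⁻¹ ≤ Real.log (n + 2) - Real.log (n + 1) := by
    have h3 := Real.log_le_sub_one_of_pos (x := ((n : ℝ) + 1) / (n + 2)) (by positivity)
    rw [Real.log_div (by positivity) (by positivity)] at h3
    have h4 : ((n : ℝ) + 1) / (n + 2) - 1 = -((n : ℝ) + 2)⁻¹ := by field_simp; ring
    linarith
  have hmono : Real.log (n + 1) ≤ Real.log (n + 2) :=
    Real.log_le_log (by positivity) (by linarith)
  rw [decayRate, decayRate, hcast]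
  set a := Real.log (n + 1)
  set b := Real.log (n + 2)
  have h5 : κ₀ * (1 + b)⁻¹ * (κ₀ * (1 + a)⁻¹ - κ₀ * (1 + b)⁻¹)
      = κ₀ ^ 2 * (b - a) / ((1 + a) * (1 + b) ^ 2) := by field_simp; ring
  rw [h5, rateGrowth]
  calc κ₀ ^ 2 / (((n : ℝ) + 2) * (1 + b) ^ 3)
      = κ₀ ^ 2 * ((n : ℝ) + 2)⁻¹ / ((1 + b) * (1 + b) ^ 2) := by
        field_simp
    _ ≤ _ := by gcongr

lemma decayRate_succ_lt {κ₀ : ℝ} (h : 0 < κ₀) (n : ℕ) :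
    0 < decayRate κ₀ n - decayRate κ₀ (n + 1) := by
  have h1 := le_decayRate_mul_sub h n
  have h2 : 0 < κ₀ ^ 2 / rateGrowth n := div_pos (by positivity) (rateGrowth_pos n)
  exact pos_of_mul_pos_right (h2.trans_le h1) (decayRate_pos h _).le

/-- With `r = ν/ν₀`, the definition of `n_*` gives `n + 2 ≤ r/(1 + log r)³`. In particular `n + 2 ≤
r`, so the logarithm in `rateGrowth` is at most `log r` and the cubes cancel. -/
lemma rateGrowth_le_of_lt_nStar {ν ν₀ : ℝ} (hν₀ : 0 < ν₀) (h : ν₀ ≤ ν) {n : ℕ}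
    (hn : n < nStar ν ν₀) : rateGrowth n ≤ ν / ν₀ := by
  have hr : 1 ≤ ν / ν₀ := (one_le_div hν₀).2 h
  have hl := Real.log_nonneg hr
  have h2 := log_natCast_add_nonneg n (one_le_two)
  unfold nStar at hn
  set r := ν / ν₀
  have h1 : n + 2 ≤ ⌊r / (1 + Real.log r) ^ 3⌋₊ := by omega
  have h3 : ((n : ℝ) + 2) ≤ r / (1 + Real.log r) ^ 3 := by
    have := (Nat.le_floor_iff (by positivity)).1 h1
    exact_mod_cast this
  have h4 : (1 : ℝ) ≤ (1 + Real.log r) ^ 3 := one_le_pow₀ (by linarith)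
  have h5 : (n : ℝ) + 2 ≤ r := h3.trans (div_le_self (by linarith) h4)
  have h6 : Real.log (n + 2) ≤ Real.log r := Real.log_le_log (by positivity) h5
  calc rateGrowth n ≤ r / (1 + Real.log r) ^ 3 * (1 + Real.log r) ^ 3 := by
        unfold rateGrowth; gcongr
    _ = r := by field_simp

/-- The relative size of the `n`-th transformation. -/
noncomputable def stepSize (n : ℕ) : ℝ := 5 / 108 * (rateGrowth n * (2 / 3) ^ n)

lemma stepSize_nonneg (n : ℕ) : 0 ≤ stepSize n := by
  have := rateGrowth_pos n
  unfold stepSize; positivity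

lemma summable_stepSize : Summable stepSize := by
  have h1 : Summable fun n : ℕ => ((n : ℝ) ^ 4 * (2 / 3) ^ n) :=
    summable_pow_mul_geometric_of_norm_lt_one 4 (by rw [Real.norm_eq_abs, abs_of_pos] <;> norm_num)
  refine Summable.mul_left _ (Summable.of_nonneg_of_le
    (fun n => by have := rateGrowth_pos n; positivity) (fun n => ?_)
    (((summable_nat_add_iff 2).2 h1).mul_left (9 / 4)))
  have h2 := log_natCast_add_nonneg n (one_le_two)
  have h3 : 1 + Real.log (n + 2) ≤ n + 2 := by
    linarith [Real.log_le_sub_one_of_pos (x := (n : ℝ) + 2) (by positivity)]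
  calc rateGrowth n * (2 / 3) ^ n ≤ (((n : ℝ) + 2) * (n + 2) ^ 3) * (2 / 3) ^ n := by
        unfold rateGrowth; gcongr
    _ = _ := by push_cast; ring

/-- The constant in the bounds on the dressing transformation. -/
noncomputable def dressingConst : ℝ := 2 * Real.exp (∑' n, stepSize n)

lemma exp_sum_stepSize_le (m : ℕ) :
    Real.exp (∑ n ∈ Finset.range m, stepSize n) ≤ dressingConst / 2 := by
  rw [dressingConst, mul_div_cancel_left₀ _ two_ne_zero]
  exact Real.exp_le_exp.2 (summable_stepSize.sum_le_tsum _ fun n _ => stepSize_nonneg n)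

end Rates

/-! ### The scalar recursions. -/

section Recursion

/-- The real recursion behind the renormalization. Here `v`, `D`, `D'` and `w` are the norms of the
off-diagonal part, of the diagonal part, of the change of the diagonal part and of the perturbation
produced by a step, and `η` is the relative size of the generator. -/
lemma recursion_bounds {v D D' w η : ℕ → ℝ} {ρ M : ℝ} {m : ℕ} (hM : 0 < M)
    (hMd : M = D 0 + 2 * v 0) (hD0 : 0 ≤ D 0) (hv0 : ∀ n, 0 ≤ v n) (hD'0 : D' 0 ≤ 0)
    (hη0 : ∀ n, 0 ≤ η n) (hρ0 : 0 ≤ ρ)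
    (hη : ∀ n < m, η n ≤ rateGrowth n * ρ * (v n / (54 * M)))
    (hρ : ∀ n < m, rateGrowth n * ρ ≤ 1)
    (hw : ∀ n < m, η n ≤ 1 / 20 → w n ≤ 5 * η n * (D n + v n))
    (hv : ∀ n < m, v (n + 1) ≤ 2 * w n) (hD : ∀ n < m, D (n + 1) ≤ D n + w n)
    (hD' : ∀ n < m, D' (n + 1) ≤ D' n + w n) (n : ℕ) (hn : n ≤ m) :
    v n ≤ (2 / 3) ^ n * v 0 ∧ D n ≤ D 0 + v 0 * (1 - (2 / 3) ^ n) ∧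
      D' n ≤ 2 * ρ * v 0 * ∑ j ∈ Finset.range n, stepSize j := by
  induction n with
  | zero => simpa using hD'0
  | succ n ih =>
    obtain ⟨h1, h2, h3⟩ := ih (by omega)
    have hlt : n < m := hn
    have hp : (0 : ℝ) < (2 / 3) ^ n := by positivity
    have hp1 : (2 / 3 : ℝ) ^ n ≤ 1 := pow_le_one₀ (by norm_num) (by norm_num)
    have hv00 := hv0 0
    have hvn := hv0 n
    have h4 : v n ≤ v 0 := h1.trans (mul_le_of_le_one_left hv00 hp1)
    -- What the diagonal part may have gained, `v 0 * (1 - (2/3)^n)`, and what is left of the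
    -- off-diagonal part add up to at most `v 0`.
    have h5 : D n + v n ≤ M := by rw [hMd]; nlinarith
    have h6 : 0 ≤ v n / (54 * M) := by positivity
    have h7 : η n ≤ v n / (54 * M) :=
      (hη n hlt).trans (mul_le_of_le_one_left h6 (hρ n hlt))
    have h8 : v n / (54 * M) ≤ 1 / 54 := by
      rw [div_le_div_iff₀ (by positivity) (by norm_num)]; nlinarith
    have h9 : w n ≤ 5 * η n * M := (hw n hlt (by linarith)).trans
      (mul_le_mul_of_nonneg_left h5 (by linarith [hη0 n]))
    -- Doubled, this is `5/27 ≤ 2/3`, the contraction of `v`; and `5/54 ≤ 1/3` keeps the bound on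
    -- `D`.
    have h10 : w n ≤ 5 / 54 * v n := by
      calc w n ≤ 5 * (v n / (54 * M)) * M := h9.trans (by gcongr)
        _ = _ := by field_simp
    -- The same bound without spending `rateGrowth n * ρ ≤ 1`, so that the factor `ρ` survives.
    have h11 : w n ≤ 2 * ρ * v 0 * stepSize n := by
      have hgρ : 0 ≤ rateGrowth n * ρ := mul_nonneg (rateGrowth_pos n).le hρ0
      calc w n ≤ 5 * (rateGrowth n * ρ * (v n / (54 * M))) * M :=
            h9.trans (by have := hη n hlt; gcongr)
        _ = 5 / 54 * (rateGrowth n * ρ) * v n := by field_simp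
        _ ≤ 5 / 54 * (rateGrowth n * ρ) * ((2 / 3) ^ n * v 0) := by gcongr
        _ = _ := by rw [stepSize]; ring
    refine ⟨?_, ?_, ?_⟩
    · have := hv n hlt
      rw [pow_succ]; nlinarith
    · have := hD n hlt
      rw [pow_succ]; nlinarith
    · rw [Finset.sum_range_succ, mul_add]
      linarith [hD' n hlt]

/-- A discrete Gronwall inequality. Since `ρ ≤ 1`, the feedback `z n + c` is bounded by `c` times
the exponential without `ρ`, and the overall factor `ρ` is kept. -/
lemma recursion_dressed {z e : ℕ → ℝ} {ρ c : ℝ} {m : ℕ} (hρ0 : 0 ≤ ρ) (hρ1 : ρ ≤ 1) (hc : 0 ≤ c)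
    (hz0 : z 0 ≤ 0) (he : ∀ n, 0 ≤ e n)
    (hz : ∀ n < m, z (n + 1) ≤ z n + ρ * e n * (z n + c)) (n : ℕ) (hn : n ≤ m) :
    z n ≤ ρ * c * (Real.exp (∑ j ∈ Finset.range n, e j) - 1) := by
  induction n with
  | zero => simpa using hz0
  | succ n ih =>
    have h1 := ih (by omega)
    set E := Real.exp (∑ j ∈ Finset.range n, e j) with hE
    have hE1 : 1 ≤ E := Real.one_le_exp (Finset.sum_nonneg fun j _ => he j)
    have h2 : 1 + e n ≤ Real.exp (e n) := by linarith [Real.add_one_le_exp (e n)]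
    rw [Finset.sum_range_succ, Real.exp_add, ← hE]
    have hρe : 0 ≤ ρ * e n := mul_nonneg hρ0 (he n)
    have h3 : z n + c ≤ c * E := by
      have : ρ * c * (E - 1) ≤ c * (E - 1) := by
        rw [mul_assoc]
        exact mul_le_of_le_one_left (mul_nonneg hc (by linarith)) hρ1
      linarith
    calc z (n + 1) ≤ z n + ρ * e n * (z n + c) := hz n hn
      _ ≤ ρ * c * (E - 1) + ρ * e n * (c * E) := by gcongr
      _ = ρ * c * (E * (1 + e n) - 1) := by ring
      _ ≤ ρ * c * (E * Real.exp (e n) - 1) := by gcongr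

end Recursion

end SpinSystem

namespace SpinSystem

/-! ### The iterated renormalization and its bounds. -/

section Iteration

variable {d : ℕ} {Λ : Finset (Fin d → ℤ)} {q : ℕ}

/-- The potential obtained from `H` after `n` steps of the renormalization. -/
noncomputable def renormSeq (N : Λ → Op Λ q) (ν : ℝ) (H : Family Λ q) (n : ℕ) : Family Λ q :=
  (renormalize N ν)^[n] H

/-- The generator of step `n`. The procedure stops after the `m` steps `0, …, m - 1`, which is what
the decay rate `decayRate κ₀ m` allows, so that the generators vanish from step `m` on. -/
noncomputable def generatorSeq (N : Λ → Op Λ q) (ν : ℝ) (H : Family Λ q) (m n : ℕ) : Family Λ q :=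
  if n < m then generator N ν (offPot N (renormSeq N ν H n)) else 0

/-- The size of the generator of step `n` relative to the spacing of the decay rates. -/
noncomputable def generatorRatio (N : Λ → Op Λ q) (ν : ℝ) (H : Family Λ q) (κ₀ : ℝ) (n : ℕ) : ℝ :=
  potNorm (decayRate κ₀ n) (generator N ν (offPot N (renormSeq N ν H n))) /
    (decayRate κ₀ (n + 1) * (decayRate κ₀ n - decayRate κ₀ (n + 1)))

attribute [local irreducible] potNorm

variable {N : Λ → Op Λ q} {H : Family Λ q} {κ₀ ν : ℝ}

lemma renormSeq_succ (N : Λ → Op Λ q) (ν : ℝ) (H : Family Λ q) (n : ℕ) :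
    renormSeq N ν H (n + 1) = renormalize N ν (renormSeq N ν H n) :=
  Function.iterate_succ_apply' _ _ _

lemma IsNumberFamily.isPotential_renormSeq (hN : IsNumberFamily N) (ν : ℝ) (hH : IsPotential H)
    (n : ℕ) : IsPotential (renormSeq N ν H n) := by
  induction n with
  | zero => exact hH
  | succ n ih => rw [renormSeq_succ]; exact hN.isPotential_renormalize ν ih

lemma IsNumberFamily.isHermitian_renormSeq (hN : IsNumberFamily N) (ν : ℝ)
    (hH : IsHermitianFamily H) (n : ℕ) : IsHermitianFamily (renormSeq N ν H n) := by
  induction n with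
  | zero => exact hH
  | succ n ih => rw [renormSeq_succ]; exact hN.isHermitian_renormalize ν ih

lemma IsNumberFamily.isPotential_generatorSeq (hN : IsNumberFamily N) (ν : ℝ)
    (hH : IsPotential H) (m n : ℕ) : IsPotential (generatorSeq N ν H m n) := by
  unfold generatorSeq
  split_ifs
  · exact hN.isPotential_generator ν (hN.isPotential_offPot (hN.isPotential_renormSeq ν hH n))
  · exact isPotential_zero

lemma IsNumberFamily.isAntiHermitian_generatorSeq (hN : IsNumberFamily N) (ν : ℝ)
    (hH : IsHermitianFamily H) (m n : ℕ) : IsAntiHermitianFamily (generatorSeq N ν H m n) := by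
  unfold generatorSeq
  split_ifs
  · exact hN.isAntiHermitian_generator ν (hN.isHermitian_offPot (hN.isHermitian_renormSeq ν hH n))
  · exact fun S => by simp

lemma dressPot_generatorSeq (N : Λ → Op Λ q) (ν : ℝ) (H : Family Λ q) {m n : ℕ} (hn : n ≤ m) :
    dressPot (generatorSeq N ν H m) ((ν : ℂ) • numPot N + H) n
      = (ν : ℂ) • numPot N + renormSeq N ν H n := by
  induction n with
  | zero => rfl
  | succ n ih =>
    rw [dressPot, ih (by omega), generatorSeq, if_pos (by omega), renormSeq_succ, renormalize]
    abel

/-- The generator of index `m` is zero, so `m + 1` exponentials still amount to `m` steps, ending at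
the rate `decayRate κ₀ m`. -/
lemma dressPot_generatorSeq_succ (N : Λ → Op Λ q) (ν : ℝ) (H Z : Family Λ q) (m : ℕ) :
    dressPot (generatorSeq N ν H m) Z (m + 1) = dressPot (generatorSeq N ν H m) Z m := by
  rw [dressPot, generatorSeq, if_neg (lt_irrefl m), expAd_zero]

lemma generatorRatio_nonneg (N : Λ → Op Λ q) (ν : ℝ) (H : Family Λ q) (hκ : 0 < κ₀) (n : ℕ) :
    0 ≤ generatorRatio N ν H κ₀ n :=
  div_nonneg (potNorm_nonneg _ _)
    (mul_pos (decayRate_pos hκ _) (decayRate_succ_lt hκ n)).le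

/-- The auxiliary `54 * M` cancels. It is inserted so that, for `M = ‖D‖ + 2‖V‖`, the middle factor
is exactly `ν₀/ν`. -/
lemma IsNumberFamily.generatorRatio_le (hN : IsNumberFamily N) (hH : IsPotential H) (hκ : 0 < κ₀)
    (hν : 0 < ν) {M : ℝ} (hM : 0 < M) (n : ℕ) :
    generatorRatio N ν H κ₀ n ≤ rateGrowth n * (54 * Real.pi / κ₀ ^ 2 * M / ν) *
      (potNorm (decayRate κ₀ n) (offPot N (renormSeq N ν H n)) / (54 * M)) := by
  have hg := rateGrowth_pos n
  have hp := Real.pi_pos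
  have h1 := hN.potNorm_generator_le hν (decayRate κ₀ n)
    (hN.isPotential_offPot (hN.isPotential_renormSeq ν hH n))
  have hv := potNorm_nonneg (decayRate κ₀ n) (offPot N (renormSeq N ν H n))
  set v := potNorm (decayRate κ₀ n) (offPot N (renormSeq N ν H n))
  calc generatorRatio N ν H κ₀ n ≤ Real.pi / ν * v / (κ₀ ^ 2 / rateGrowth n) := by
        exact div_le_div₀ (by positivity) h1 (by positivity) (le_decayRate_mul_sub hκ n)
    _ = _ := by field_simp

lemma decayRate_succ_add (κ₀ : ℝ) (n : ℕ) :
    decayRate κ₀ (n + 1) + (decayRate κ₀ n - decayRate κ₀ (n + 1)) = decayRate κ₀ n := by ring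

lemma decayRate_le {κ₀ : ℝ} (hκ : 0 < κ₀) (n : ℕ) : decayRate κ₀ n ≤ κ₀ := by
  induction n with
  | zero => rw [decayRate_zero]
  | succ n ih => linarith [decayRate_succ_lt hκ n]

lemma IsNumberFamily.potNorm_renormSeq_step_le (hN : IsNumberFamily N) (hH : IsPotential H)
    (hκ : 0 < κ₀) (hν : 0 < ν) (n : ℕ) (hη : generatorRatio N ν H κ₀ n ≤ 1 / 20) :
    potNorm (decayRate κ₀ (n + 1)) (renormSeq N ν H (n + 1) - diagPot N (renormSeq N ν H n)) ≤
      5 * generatorRatio N ν H κ₀ n * (potNorm (decayRate κ₀ n) (diagPot N (renormSeq N ν H n))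
        + potNorm (decayRate κ₀ n) (offPot N (renormSeq N ν H n))) := by
  have h := hN.potNorm_renormalize_sub_le hν (decayRate_pos hκ (n + 1)) (decayRate_succ_lt hκ n)
    (hN.isPotential_renormSeq ν hH n) (by rw [decayRate_succ_add]; exact hη)
  rw [decayRate_succ_add] at h
  rw [renormSeq_succ]
  exact h

lemma IsNumberFamily.renormSeq_bounds (hN : IsNumberFamily N) (hH : IsPotential H) (hκ : 0 < κ₀)
    (hν₀ : 0 < nuZero κ₀ N H) (hν : nuZero κ₀ N H ≤ ν) {n : ℕ}
    (hn : n ≤ nStar ν (nuZero κ₀ N H)) :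
    potNorm (decayRate κ₀ n) (offPot N (renormSeq N ν H n)) ≤
        (2 / 3) ^ n * potNorm κ₀ (offPot N H) ∧
      potNorm (decayRate κ₀ n) (diagPot N (renormSeq N ν H n) - diagPot N H) ≤
        2 * (nuZero κ₀ N H / ν) * potNorm κ₀ (offPot N H) *
          ∑ j ∈ Finset.range n, stepSize j := by
  have hpi := Real.pi_pos
  have hνpos : 0 < ν := hν₀.trans_le hν
  have hpot := hN.isPotential_renormSeq ν hH
  have hdiag := fun n => hN.isPotential_diagPot (hpot n)
  have hM : 0 < potNorm κ₀ (diagPot N H) + 2 * potNorm κ₀ (offPot N H) :=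
    pos_of_mul_pos_right hν₀ (by positivity)
  have hW := fun n => (hpot (n + 1)).sub (hdiag n)
  have hle := fun n => (sub_pos.1 (decayRate_succ_lt hκ n)).le
  have hstep : ∀ n, diagPot N (renormSeq N ν H (n + 1)) - diagPot N (renormSeq N ν H n)
      = diagPot N (renormSeq N ν H (n + 1) - diagPot N (renormSeq N ν H n)) := fun n => by
    rw [renormSeq_succ, hN.diagPot_renormalize_sub]
  have hmain := recursion_bounds
    (v := fun n => potNorm (decayRate κ₀ n) (offPot N (renormSeq N ν H n)))
    (D := fun n => potNorm (decayRate κ₀ n) (diagPot N (renormSeq N ν H n)))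
    (D' := fun n => potNorm (decayRate κ₀ n) (diagPot N (renormSeq N ν H n) - diagPot N H))
    (w := fun n => potNorm (decayRate κ₀ (n + 1))
      (renormSeq N ν H (n + 1) - diagPot N (renormSeq N ν H n)))
    (η := generatorRatio N ν H κ₀) (ρ := nuZero κ₀ N H / ν) (m := nStar ν (nuZero κ₀ N H)) hM
    (by simp only [decayRate_zero]; rfl) (potNorm_nonneg _ _) (fun n => potNorm_nonneg _ _)
    (by
      have := potNorm_smul_le (decayRate κ₀ 0) 0 (isPotential_zero (Λ := Λ) (q := q))
      simpa [renormSeq] using this)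
    (generatorRatio_nonneg N ν H hκ) (by positivity)
    (fun n _ => hN.generatorRatio_le hH hκ hνpos hM n)
    (fun n hn => by
      have h := rateGrowth_le_of_lt_nStar hν₀ hν hn
      rw [← inv_div, ← div_eq_mul_inv, div_le_one (by positivity)]
      exact h)
    (fun n _ => hN.potNorm_renormSeq_step_le hH hκ hνpos n)
    (fun n _ => by
      simp only [renormSeq_succ]
      exact hN.potNorm_offPot_renormalize_le ν _ (hpot n))
    (fun n _ => by
      have h1 := potNorm_add_le (decayRate κ₀ (n + 1)) (hdiag n) (hN.isPotential_diagPot (hW n))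
      rw [← hstep, add_sub_cancel, hstep] at h1
      linarith [potNorm_mono (hle n) (hdiag n),
        hN.potNorm_diagPot_le (decayRate κ₀ (n + 1)) (hW n)])
    (fun n _ => by
      have hd := (hdiag n).sub (hN.isPotential_diagPot hH)
      have h1 := potNorm_add_le (decayRate κ₀ (n + 1)) (hN.isPotential_diagPot (hW n)) hd
      rw [← hstep, sub_add_sub_cancel, hstep] at h1
      linarith [potNorm_mono (hle n) hd, hN.potNorm_diagPot_le (decayRate κ₀ (n + 1)) (hW n)])
    n hn
  obtain ⟨h1, -, h3⟩ := hmain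
  simp only [decayRate_zero] at h1 h3
  exact ⟨h1, h3⟩

lemma IsNumberFamily.five_mul_generatorRatio_le (hN : IsNumberFamily N) (hH : IsPotential H)
    (hκ : 0 < κ₀) (hν₀ : 0 < nuZero κ₀ N H) (hν : nuZero κ₀ N H ≤ ν) {n : ℕ}
    (hn : n < nStar ν (nuZero κ₀ N H)) :
    5 * generatorRatio N ν H κ₀ n ≤ nuZero κ₀ N H / ν * stepSize n ∧
      generatorRatio N ν H κ₀ n ≤ 1 / 20 := by
  have hpi := Real.pi_pos
  have hνpos : 0 < ν := hν₀.trans_le hν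
  have hM : 0 < potNorm κ₀ (diagPot N H) + 2 * potNorm κ₀ (offPot N H) :=
    pos_of_mul_pos_right hν₀ (by positivity)
  have h1 := hN.generatorRatio_le hH hκ hνpos hM n
  have h2 := (hN.renormSeq_bounds hH hκ hν₀ hν hn.le).1
  have h3 := rateGrowth_le_of_lt_nStar hν₀ hν hn
  have hg := rateGrowth_pos n
  have hD := potNorm_nonneg κ₀ (diagPot N H)
  have hV := potNorm_nonneg κ₀ (offPot N H)
  change _ ≤ rateGrowth n * (nuZero κ₀ N H / ν) * _ at h1
  set M := potNorm κ₀ (diagPot N H) + 2 * potNorm κ₀ (offPot N H) with hMd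
  -- `2‖V‖ ≤ M` turns `54` into `108`, the denominator in `stepSize`.
  have h4 : potNorm (decayRate κ₀ n) (offPot N (renormSeq N ν H n)) / (54 * M)
      ≤ (2 / 3) ^ n / 108 := by
    rw [div_le_div_iff₀ (by positivity) (by norm_num)]
    have hp : (0 : ℝ) < (2 / 3) ^ n := by positivity
    nlinarith
  have h5 : generatorRatio N ν H κ₀ n
      ≤ rateGrowth n * (nuZero κ₀ N H / ν) * ((2 / 3) ^ n / 108) :=
    h1.trans (mul_le_mul_of_nonneg_left h4 (by positivity))
  refine ⟨?_, ?_⟩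
  · rw [stepSize]; linarith
  · have h6 : rateGrowth n * (nuZero κ₀ N H / ν) ≤ 1 := by
      rw [← inv_div, ← div_eq_mul_inv, div_le_one (by positivity)]
      exact h3
    have h7 : (2 / 3 : ℝ) ^ n ≤ 1 := pow_le_one₀ (by norm_num) (by norm_num)
    have h8 : rateGrowth n * (nuZero κ₀ N H / ν) * ((2 / 3) ^ n / 108) ≤ 1 * (1 / 108) := by
      gcongr
    linarith

/-- Each exponential moves its argument by at most `(ν₀/ν) * stepSize n` times its norm, which is
bounded by the accumulated change plus `‖Z‖`; `recursion_dressed` sums this up. -/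
lemma IsNumberFamily.potNorm_dressPot_sub_le (hN : IsNumberFamily N) (hH : IsPotential H)
    (hκ : 0 < κ₀) (hν₀ : 0 < nuZero κ₀ N H) (hν : nuZero κ₀ N H ≤ ν) {Z : Family Λ q}
    (hZ : IsPotential Z) {n : ℕ} (hn : n ≤ nStar ν (nuZero κ₀ N H)) :
    potNorm (decayRate κ₀ n)
        (dressPot (generatorSeq N ν H (nStar ν (nuZero κ₀ N H))) Z n - Z) ≤
      nuZero κ₀ N H / ν * potNorm κ₀ Z *
        (Real.exp (∑ j ∈ Finset.range n, stepSize j) - 1) := by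
  have hνpos : 0 < ν := hν₀.trans_le hν
  set m := nStar ν (nuZero κ₀ N H) with hm
  have hA := hN.isPotential_generatorSeq ν hH m
  have hpot := isPotential_dressPot hA hZ
  have hle := fun n => (sub_pos.1 (decayRate_succ_lt hκ n)).le
  refine recursion_dressed (m := m)
    (z := fun n => potNorm (decayRate κ₀ n) (dressPot (generatorSeq N ν H m) Z n - Z))
    (by positivity) ((div_le_one hνpos).2 hν) (potNorm_nonneg _ _) ?_ stepSize_nonneg
    (fun n hn => ?_) n hn
  · have := potNorm_smul_le (decayRate κ₀ 0) 0 (isPotential_zero (Λ := Λ) (q := q))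
    simpa [dressPot] using this
  · obtain ⟨h1, h2⟩ := hN.five_mul_generatorRatio_le hH hκ hν₀ hν hn
    have hAn : generatorSeq N ν H m n = generator N ν (offPot N (renormSeq N ν H n)) := if_pos hn
    have h3 := potNorm_expAd_sub_le (decayRate_pos hκ (n + 1)) (decayRate_succ_lt hκ n) (hA n)
      (hpot n) (by rw [decayRate_succ_add, hAn]; exact h2)
    rw [decayRate_succ_add, hAn] at h3
    change _ ≤ 5 * generatorRatio N ν H κ₀ n * _ at h3
    rw [← hAn] at h3
    change potNorm _ (dressPot (generatorSeq N ν H m) Z (n + 1) - _) ≤ _ at h3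
    have h4 := potNorm_add_le (decayRate κ₀ (n + 1)) ((hpot (n + 1)).sub (hpot n))
      ((hpot n).sub hZ)
    rw [sub_add_sub_cancel] at h4
    have h5 := potNorm_mono (hle n) ((hpot n).sub hZ)
    have h6 := potNorm_add_le (decayRate κ₀ n) ((hpot n).sub hZ) hZ
    rw [sub_add_cancel] at h6
    have h7 := potNorm_mono (decayRate_le hκ n) hZ
    have h8 : 5 * generatorRatio N ν H κ₀ n *
        potNorm (decayRate κ₀ n) (dressPot (generatorSeq N ν H m) Z n) ≤
        nuZero κ₀ N H / ν * stepSize n * (potNorm (decayRate κ₀ n)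
          (dressPot (generatorSeq N ν H m) Z n - Z) + potNorm κ₀ Z) :=
      mul_le_mul h1 (h6.trans (by linarith)) (potNorm_nonneg _ _)
        (mul_nonneg (by positivity) (stepSize_nonneg n))
    linarith

end Iteration

end SpinSystem

/-! ### Assembly of the theorem. -/

open SpinSystem in
theorem theorem4 :
    ∃ C : ℝ, 0 < C ∧
      ∀ (d q : ℕ) (Λ : Finset (Fin d → ℤ)) (N : Λ → Op Λ q) (H : Family Λ q) (κ₀ ν : ℝ),
        IsNumberFamily N → IsPotential H → IsHermitianFamily H →
        0 < κ₀ →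
        9 * Real.pi * potNorm κ₀ (offPot N H) / κ₀ ≤ ν →
        nuZero κ₀ N H ≤ ν →
        1 ≤ nStar ν (nuZero κ₀ N H) →
        ∃ (A : ℕ → Family Λ q) (Y : Op Λ q) (Hhat Dhat Vhat : Family Λ q),
          -- `Y = e^{A_{n_*}} ⋯ e^{A_0}` is unitary, the `A_j` being anti-Hermitian potentials
          (∀ j, IsPotential (A j) ∧ IsAntiHermitianFamily (A j)) ∧
          Y = dressing A (nStar ν (nuZero κ₀ N H) + 1) ∧
          Y ∈ Matrix.unitaryGroup (Λ → Fin q) ℂ ∧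
          -- the transformed Hamiltonian, as an operator and as a potential
          (IsPotential Hhat ∧ IsHermitianFamily Hhat) ∧
          (IsPotential Dhat ∧ IsHermitianFamily Dhat) ∧
          (IsPotential Vhat ∧ IsHermitianFamily Vhat) ∧
          Y * ((ν : ℂ) • (∑ x, N x) + toOp H) * Y.conjTranspose =
            (ν : ℂ) • (∑ x, N x) + toOp Hhat ∧
          dressPot A ((ν : ℂ) • numPot N + H) (nStar ν (nuZero κ₀ N H) + 1) =
            (ν : ℂ) • numPot N + Hhat ∧
          Hhat = Dhat + Vhat ∧
          -- 1.
          Dhat = diagPot N Hhat ∧ toOp Dhat = diagPart N (toOp Hhat) ∧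
          Commute (toOp Dhat) (∑ x, N x) ∧
          -- 2.
          potNorm (decayRate κ₀ (nStar ν (nuZero κ₀ N H))) (Dhat - diagPot N H) ≤
            C * (nuZero κ₀ N H / ν) * potNorm κ₀ (offPot N H) ∧
          potNorm (decayRate κ₀ (nStar ν (nuZero κ₀ N H))) Vhat ≤
            (2 / 3 : ℝ) ^ nStar ν (nuZero κ₀ N H) * potNorm κ₀ (offPot N H) ∧
          -- 3.
          ∀ Z : Family Λ q, IsPotential Z →
            IsPotential (dressPot A Z (nStar ν (nuZero κ₀ N H) + 1)) ∧
            Y * toOp Z * Y.conjTranspose =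
              toOp (dressPot A Z (nStar ν (nuZero κ₀ N H) + 1)) ∧
            potNorm (decayRate κ₀ (nStar ν (nuZero κ₀ N H)))
                (dressPot A Z (nStar ν (nuZero κ₀ N H) + 1) - Z) ≤
              C * (nuZero κ₀ N H / ν) * potNorm κ₀ Z := by

  refine ⟨dressingConst, by unfold dressingConst; positivity, ?_⟩
  intro d q Λ N H κ₀ ν hN hH hHh hκ _ hν hm
  -- If `ν₀` were zero, the convention `ν / 0 = 0` would make `n_*` zero, against `n_* ≥ 1`.
  have hν₀ : 0 < nuZero κ₀ N H := by
    have hpi := Real.pi_pos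
    have h0 : 0 ≤ nuZero κ₀ N H := mul_nonneg (by positivity)
      (add_nonneg (potNorm_nonneg _ _) (mul_nonneg zero_le_two (potNorm_nonneg _ _)))
    refine h0.lt_of_ne fun h => ?_
    rw [← h] at hm
    simp [nStar] at hm
  have hνpos : 0 < ν := hν₀.trans_le hν
  set m := nStar ν (nuZero κ₀ N H) with hmd
  have hA := hN.isPotential_generatorSeq ν hH m
  have hA' := hN.isAntiHermitian_generatorSeq ν hHh m
  have hP := hN.isPotential_renormSeq ν hH m
  have hP' := hN.isHermitian_renormSeq ν hHh m
  have hρ : 0 ≤ nuZero κ₀ N H / ν := by positivity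
  have hsum := exp_sum_stepSize_le m
  obtain ⟨hoff, hdiag⟩ := hN.renormSeq_bounds hH hκ hν₀ hν le_rfl
  have hdress : dressPot (generatorSeq N ν H m) ((ν : ℂ) • numPot N + H) (m + 1)
      = (ν : ℂ) • numPot N + renormSeq N ν H m := by
    rw [dressPot_generatorSeq_succ, dressPot_generatorSeq N ν H le_rfl]
  refine ⟨generatorSeq N ν H m, dressing (generatorSeq N ν H m) (m + 1), renormSeq N ν H m,
    diagPot N (renormSeq N ν H m), offPot N (renormSeq N ν H m), fun j => ⟨hA j, hA' j⟩, rfl,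
    dressing_mem_unitaryGroup hA' _, ⟨hP, hP'⟩,
    ⟨hN.isPotential_diagPot hP, hN.isHermitian_diagPot hP'⟩,
    ⟨hN.isPotential_offPot hP, hN.isHermitian_offPot hP'⟩, ?_, hdress,
    (diagPot_add_offPot N _).symm, rfl, hN.toOp_diagPot _, ?_, ?_, hoff, fun Z hZ => ⟨
      isPotential_dressPot hA hZ _, (toOp_dressPot hA' Z _).symm, ?_⟩⟩
  · have h := toOp_dressPot hA' ((ν : ℂ) • numPot N + H) (m + 1)
    rw [hdress, toOp_add, toOp_add, toOp_smul, toOp_numPot] at h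
    exact h.symm
  · rw [hN.toOp_diagPot]
    exact (hN.commute_diagPart _).symm
  -- A sum is bounded by its exponential, so one constant serves both estimates; the half absorbs
  -- the factor `2` in the bound on the diagonal part.
  · have h1 : ∑ j ∈ Finset.range m, stepSize j ≤ dressingConst / 2 := by
      linarith [Real.add_one_le_exp (∑ j ∈ Finset.range m, stepSize j)]
    calc _ ≤ 2 * (nuZero κ₀ N H / ν) * potNorm κ₀ (offPot N H) *
          ∑ j ∈ Finset.range m, stepSize j := hdiag
      _ ≤ 2 * (nuZero κ₀ N H / ν) * potNorm κ₀ (offPot N H) * (dressingConst / 2) :=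
          mul_le_mul_of_nonneg_left h1
            (mul_nonneg (mul_nonneg zero_le_two hρ) (potNorm_nonneg _ _))
      _ = _ := by ring
  · have h1 : Real.exp (∑ j ∈ Finset.range m, stepSize j) - 1 ≤ dressingConst := by
      have : 0 ≤ dressingConst := by unfold dressingConst; positivity
      linarith
    rw [dressPot_generatorSeq_succ]
    calc _ ≤ nuZero κ₀ N H / ν * potNorm κ₀ Z *
          (Real.exp (∑ j ∈ Finset.range m, stepSize j) - 1) :=
          hN.potNorm_dressPot_sub_le hH hκ hν₀ hν hZ le_rfl
      _ ≤ nuZero κ₀ N H / ν * potNorm κ₀ Z * dressingConst :=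
          mul_le_mul_of_nonneg_left h1 (mul_nonneg hρ (potNorm_nonneg _ _))
      _ = _ := by ring
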